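/- Let $\mathcal G$ be a finite connected simple graph with edge set $E(\mathcal G)$, $|E(\mathcal G)|\ge 2$. Let $w:\{0,1,2,\dots\}\to(0,\infty)$, let $(\ell_0^e)_{e\in E(\mathcal G)}$ be non-negative integers, put $t_0=\sum_e \ell_0^e$, and let $v_0$ be a vertex. Let $(I_n)_{n\ge t_0}$ be the edge-reinforced random walk on $\mathcal G$ with these data: $I_{t_0}=v_0$ almost surely, and for all $n\ge t_0$ and all vertices $v$, $$P(I_{n+1}=v\mid I_{t_0},\dots,I_n)=\frac{w(X_n^{\{I_n,v\}})}{\sum_{y\sim I_n}w(X_n^{\{I_n,y\}})}\,1_{\{I_n\sim v\}},\qquad X_n^e=\ell_0^e+\#\{t_0\le i<n:\{I_i,I_{i+1}\}=e\}.$$ Let $T=\inf\{k\ge t_0:\ \{I_n,I_{n+1}\}=\{I_{n+1},I_{n+2}\}\ \text{for all } n\ge k\}$ (with $\inf\emptyset=\infty$) be the time of attraction. Let $\rho>1$ and $\rho_c=1+\frac{1+\sqrt5}{2}$. (a) If $w(k)=k^\rho$ for all $k\ge1$, then $E^{\mathcal G}(T)=\infty$ if $\rho\le\rho_c$, and $E^{\mathcal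 G}(T)<\infty$ if $\rho>\rho_c$. (b) If $w(k)=k^\rho\log^\alpha k$ for all $k\ge2$, where $\alpha>0$, then $E^{\mathcal G}(T)=\infty$ if $\rho<\rho_c$, and $E^{\mathcal G}(T)<\infty$ if $\rho>\rho_c$. If $\rho=\rho_c$, then $E^{\mathcal G}(T)=\infty$ when $\alpha\le1$, and $E^{\mathcal G}(T)<\infty$ when $\alpha>1$. -/

import Mathlib

open MeasureTheory ProbabilityTheory
open scoped ENNReal

namespace ReinforcedWalk

section Paths

variable {V : Type*} [DecidableEq V]

/-- The weight of the edge `e` after `n` steps along the trajectory `x`: its initial weight plus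
the number of (undirected) traversals of `e` among the first `n` steps. -/
def edgeWeight (ℓ₀ : Sym2 V → ℕ) (x : ℕ → V) (n : ℕ) (e : Sym2 V) : ℕ :=
  ℓ₀ e + ((Finset.range n).filter fun i => s(x i, x (i + 1)) = e).card

variable [Fintype V] (G : SimpleGraph V) [DecidableRel G.Adj]

/-- The conditional probability that the walk, having followed `x` for `n` steps, jumps to `v`. -/
noncomputable def stepProb (w : ℕ → ℝ) (ℓ₀ : Sym2 V → ℕ) (x : ℕ → V) (n : ℕ) (v : V) : ℝ :=
  if G.Adj (x n) v then
    w (edgeWeight ℓ₀ x n s(x n, v)) / ∑ y ∈ G.neighborFinset (x n), w (edgeWeight ℓ₀ x n s(x n, y))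
  else 0

/-- The initial time: the sum of the initial weights of all edges. -/
def initialTime (ℓ₀ : Sym2 V → ℕ) : ℕ := ∑ e ∈ G.edgeFinset, ℓ₀ e

/-- The time of attraction of a trajectory: the first time after which a single edge is traversed
(`⊤` if there is none). The position at time `initialTime G ℓ₀ + n` is `x n`. -/
noncomputable def attractionTime (ℓ₀ : Sym2 V → ℕ) (x : ℕ → V) : ℕ∞ :=
  (initialTime G ℓ₀ : ℕ∞) +
    ⨅ (k : ℕ) (_ : ∀ n ≥ k, s(x n, x (n + 1)) = s(x (n + 1), x (n + 2))), (k : ℕ∞)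

end Paths

section Walk

variable {V : Type*} [Fintype V] [DecidableEq V] [MeasurableSpace V]
variable {Ω : Type*} [MeasurableSpace Ω]

/-- The history of the process `I` up to and including step `n`. -/
abbrev history (I : ℕ → Ω → V) (n : ℕ) : MeasurableSpace Ω :=
  ⨆ k ∈ Finset.range (n + 1), MeasurableSpace.comap (I k) inferInstance

/-- `I` is, under `P`, an edge-reinforced random walk on `G` with reinforcement weight function `w`,
initial edge weights `ℓ₀` (only their values on edges of `G` matter) and initial position `v₀`;
`I n` is the position after `n` steps, that is, at time `initialTime G ℓ₀ + n`. -/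
structure IsERRW (G : SimpleGraph V) [DecidableRel G.Adj] (w : ℕ → ℝ) (ℓ₀ : Sym2 V → ℕ) (v₀ : V)
    (P : Measure Ω) (I : ℕ → Ω → V) : Prop where
  measurable : ∀ n, Measurable (I n)
  initial : ∀ᵐ ω ∂P, I 0 ω = v₀
  step : ∀ (n : ℕ) (v : V),
    P[(I (n + 1) ⁻¹' {v}).indicator (fun _ => (1 : ℝ)) | history I n]
      =ᵐ[P] fun ω => stepProb G w ℓ₀ (fun i => I i ω) n v

/-- The expected time of attraction, as an element of `[0, ∞]`. -/
noncomputable def expectedAttractionTime (G : SimpleGraph V) [DecidableRel G.Adj]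
    (ℓ₀ : Sym2 V → ℕ) (P : Measure Ω) (I : ℕ → Ω → V) : ℝ≥0∞ :=
  ∫⁻ ω, (attractionTime G ℓ₀ (fun n => I n ω) : ℝ≥0∞) ∂P

end Walk

end ReinforcedWalk

set_option linter.unusedSectionVars false

/-! Both halves come down to one computation: up to constants, the probability that attraction
occurs after step `N` is at least `N ^ (-γ) * log N ^ (-α)` with `γ = (ρ - 1) ^ 2 / ρ`, and `E(T)`
is controlled from above by the series of the same terms (for `ρ > 2`, plus convergent ones). Since
`γ = 1` exactly when `ρ ^ 2 - 3 * ρ + 1 = 0`, the threshold is `ρ_c = 1 + (1 + √5) / 2`; at `γ = 1`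
the logarithm decides.

Upper bound. The pair (position, edge counts) is a Markov chain, and the measure giving `(x, n)` the
mass `W_x(n) * ∏ 1 / w(n_g)`, where `W_x` is the total weight at `x`, dominates its law at every
time up to a constant (`IsERRW.measureReal_stateSet_le`). Hence the probability of reaching a vertex
by an edge of count `b` and leaving it by a different edge of count `a`, without changing edge for a
long while afterwards, is bounded by `stickWeight` times a product of factors `1 / w(n_g)` over the
other edges. Summed over all counts, these bounds show that edge switches have finite expected
number, so that they a.s. stop, and that the time of the last switch has finite mean. The dominant
part of the sum is `∑_{b < a} min (a / w a) (1 / w b)`, whose crossover at `b = a ^ (1 - 1/ρ)`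
produces `a ^ (-γ)`.

Lower bound. As `∑ 1 / w < ∞`, with positive probability the walk makes only round trips from a
fixed vertex `x` along two of its edges. Round trips form a two-colour urn with colour weights `A
i`, `B j`, whose visiting probabilities obey a recursion solved exactly by `1 / A i + 1 / B j`; the
losses to other edges cost only a constant (`exists_le_of_urn_recursion`). So a round trip along the
second edge in state `(i, j)` has probability at least a multiple of `1 / A i`. Summing over `i` of
order `N` and `j` up to `N ^ (1 - 1/ρ)`, the range in which the first edge can still take over with
probability bounded below, gives `N ^ (-γ)` again. -/

namespace ReinforcedWalk

/-! ### Edge counts and total weights at a vertex -/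

section Counts

variable {V : Type*} [DecidableEq V]

lemma edgeWeight_zero (ℓ₀ : Sym2 V → ℕ) (x : ℕ → V) : edgeWeight ℓ₀ x 0 = ℓ₀ := by
  ext e; simp [edgeWeight]

lemma edgeWeight_succ (ℓ₀ : Sym2 V → ℕ) (x : ℕ → V) (n : ℕ) :
    edgeWeight ℓ₀ x (n + 1) = edgeWeight ℓ₀ x n + Pi.single s(x n, x (n + 1)) 1 := by
  ext e
  simp only [edgeWeight, Finset.range_add_one, Finset.filter_insert, Pi.add_apply, Pi.single_apply]
  by_cases h : s(x n, x (n + 1)) = e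
  · rw [if_pos h, if_pos h.symm, Finset.card_insert_of_notMem (by simp)]; ring
  · rw [if_neg h, if_neg (Ne.symm h)]; ring

/-- The counts thus determine the time, so a state can be occupied at one time only, and sums over
time turn into sums over counts. -/
lemma sum_edgeWeight [Fintype V] (ℓ₀ : Sym2 V → ℕ) (x : ℕ → V) (n : ℕ) :
    ∑ e, edgeWeight ℓ₀ x n e = n + ∑ e, ℓ₀ e := by
  induction n with
  | zero => simp [edgeWeight_zero]
  | succ n ih => rw [edgeWeight_succ]; simp [Finset.sum_add_distrib, ih]; ring

lemma edgeWeight_mono (ℓ₀ : Sym2 V → ℕ) (x : ℕ → V) : Monotone (edgeWeight ℓ₀ x) := by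
  refine monotone_nat_of_le_succ fun n => ?_
  rw [edgeWeight_succ]; exact le_self_add

end Counts

/-- The total weight of the edges at `x`, when the edge counts are `n`. -/
def vertexWeight {V : Type*} [Fintype V] (G : SimpleGraph V) [DecidableRel G.Adj] (w : ℕ → ℝ)
    (n : Sym2 V → ℕ) (x : V) : ℝ :=
  ∑ y ∈ G.neighborFinset x, w (n s(x, y))

section VertexWeight

variable {V : Type*} [Fintype V] {G : SimpleGraph V} [DecidableRel G.Adj] {w : ℕ → ℝ}

lemma vertexWeight_pos (hw : ∀ k, 0 < w k) {x y : V} (h : G.Adj x y) (n : Sym2 V → ℕ) :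
    0 < vertexWeight G w n x :=
  Finset.sum_pos (fun _ _ => hw _) ⟨y, by simpa using h⟩

lemma add_le_vertexWeight (hw : ∀ k, 0 < w k) {x y z : V} (h : G.Adj x y) (h' : G.Adj x z)
    (hyz : y ≠ z) (n : Sym2 V → ℕ) :
    w (n s(x, y)) + w (n s(x, z)) ≤ vertexWeight G w n x := by
  classical
  rw [← Finset.sum_pair (f := fun y => w (n s(x, y))) hyz]
  refine Finset.sum_le_sum_of_subset_of_nonneg ?_ fun _ _ _ => (hw _).le
  intro a ha
  simp only [Finset.mem_insert, Finset.mem_singleton] at ha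
  rcases ha with rfl | rfl <;> simpa

end VertexWeight

/-! ### The chain of positions and edge counts -/

section Walk

variable {V : Type*} [Fintype V] [DecidableEq V] [MeasurableSpace V] [DiscreteMeasurableSpace V]
variable {Ω : Type*} [MeasurableSpace Ω]

/-- The event that the walk is at `x` after `t` steps, with edge counts `n`. -/
def stateSet (ℓ₀ : Sym2 V → ℕ) (I : ℕ → Ω → V) (t : ℕ) (x : V) (n : Sym2 V → ℕ) : Set Ω :=
  {ω | I t ω = x ∧ edgeWeight ℓ₀ (fun i => I i ω) t = n}

variable {G : SimpleGraph V} [DecidableRel G.Adj] {w : ℕ → ℝ} {ℓ₀ : Sym2 V → ℕ} {v₀ : V}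
  {P : Measure Ω} {I : ℕ → Ω → V}

lemma measurable_history {k n : ℕ} (h : k ≤ n) : Measurable[history I n] (I k) := by
  refine Measurable.mono (comap_measurable (I k)) ?_ le_rfl
  exact le_iSup₂_of_le (f := fun k (_ : k ∈ Finset.range (n + 1)) =>
    MeasurableSpace.comap (I k) inferInstance) k (by simp; omega) le_rfl

lemma history_mono : Monotone (history I) := by
  intro m n h
  refine iSup₂_le fun k hk => ?_
  exact (measurable_history (by simp at hk; omega)).comap_le

lemma IsERRW.history_le (hI : IsERRW G w ℓ₀ v₀ P I) (n : ℕ) :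
    history I n ≤ (inferInstance : MeasurableSpace Ω) :=
  iSup₂_le fun k _ => (hI.measurable k).comap_le

lemma measurableSet_history_eq {k n : ℕ} (h : k ≤ n) (x : V) :
    MeasurableSet[history I n] {ω | I k ω = x} :=
  measurable_history h (measurableSet_singleton x)

lemma measurable_edgeWeight (t : ℕ) (e : Sym2 V) :
    Measurable[history I t] fun ω => edgeWeight ℓ₀ (fun i => I i ω) t e := by
  simp only [edgeWeight, Finset.card_filter]
  refine Measurable.add measurable_const (Finset.measurable_sum _ fun i hi => ?_)
  have hi' : i < t := by simpa using hi
  refine Measurable.ite ?_ measurable_const measurable_const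
  have : {ω | s(I i ω, I (i + 1) ω) = e} =
      ⋃ (a : V) (b : V) (_ : s(a, b) = e), {ω | I i ω = a} ∩ {ω | I (i + 1) ω = b} := by
    ext ω; simp
  rw [this]
  exact MeasurableSet.iUnion fun a => MeasurableSet.iUnion fun b => MeasurableSet.iUnion fun _ =>
    (measurableSet_history_eq hi'.le a).inter (measurableSet_history_eq hi' b)

lemma measurableSet_stateSet (t : ℕ) (x : V) (n : Sym2 V → ℕ) :
    MeasurableSet[history I t] (stateSet ℓ₀ I t x n) := by
  have : stateSet ℓ₀ I t x n =
      {ω | I t ω = x} ∩ ⋂ e, {ω | edgeWeight ℓ₀ (fun i => I i ω) t e = n e} := by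
    ext ω; simp [stateSet, funext_iff]
  rw [this]
  exact (measurableSet_history_eq le_rfl x).inter
    (MeasurableSet.iInter fun e => measurable_edgeWeight t e (measurableSet_singleton _))

lemma stateSet_inter_subset (t : ℕ) (x y : V) (n : Sym2 V → ℕ) :
    stateSet ℓ₀ I t x n ∩ {ω | I (t + 1) ω = y} ⊆
      stateSet ℓ₀ I (t + 1) y (n + Pi.single s(x, y) 1) := by
  rintro ω ⟨⟨h1, h2⟩, h3⟩
  change I (t + 1) ω = y at h3
  refine ⟨h3, ?_⟩
  rw [edgeWeight_succ, h1, h2, h3]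

variable [IsProbabilityMeasure P]

/-- Integrate the defining conditional probability over `D`: the event belongs to the history and
fixes position and counts, so `stepProb` is constant on it. All later estimates use the walk only
through this Markov property. -/
lemma IsERRW.measureReal_inter (hI : IsERRW G w ℓ₀ v₀ P I) {t : ℕ} {x : V} {n : Sym2 V → ℕ}
    {D : Set Ω} (hD : MeasurableSet[history I t] D) (hsub : D ⊆ stateSet ℓ₀ I t x n) (y : V) :
    P.real (D ∩ {ω | I (t + 1) ω = y}) =
      P.real D * if G.Adj x y then w (n s(x, y)) / vertexWeight G w n x else 0 := by
  have hD' : MeasurableSet D := hI.history_le t _ hD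
  have hy : MeasurableSet (I (t + 1) ⁻¹' {y}) := hI.measurable _ (measurableSet_singleton y)
  have h1 := setIntegral_condExp (hI.history_le t) (μ := P)
    (f := (I (t + 1) ⁻¹' {y}).indicator fun _ => (1 : ℝ))
    ((integrable_const _).indicator hy) hD
  rw [integral_congr_ae (ae_restrict_of_ae (hI.step t y)), setIntegral_indicator hy,
    setIntegral_const, smul_eq_mul, mul_one] at h1
  change P.real (D ∩ (I (t + 1) ⁻¹' {y})) = _
  rw [← h1, setIntegral_congr_fun hD' (g := fun _ =>
    if G.Adj x y then w (n s(x, y)) / vertexWeight G w n x else 0), setIntegral_const, smul_eq_mul]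
  intro ω hω
  obtain ⟨h2, h3⟩ := hsub hω
  subst h2 h3
  rfl

lemma IsERRW.measureReal_inter_of_adj (hI : IsERRW G w ℓ₀ v₀ P I) {t : ℕ} {x y : V}
    {n : Sym2 V → ℕ} {D : Set Ω} (hD : MeasurableSet[history I t] D)
    (hsub : D ⊆ stateSet ℓ₀ I t x n) (h : G.Adj x y) :
    P.real (D ∩ {ω | I (t + 1) ω = y}) = P.real D * (w (n s(x, y)) / vertexWeight G w n x) := by
  rw [hI.measureReal_inter hD hsub, if_pos h]

lemma IsERRW.measureReal_inter_of_not_adj (hI : IsERRW G w ℓ₀ v₀ P I) {t : ℕ} {x y : V}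
    {n : Sym2 V → ℕ} {D : Set Ω} (hD : MeasurableSet[history I t] D)
    (hsub : D ⊆ stateSet ℓ₀ I t x n) (h : ¬ G.Adj x y) :
    P.real (D ∩ {ω | I (t + 1) ω = y}) = 0 := by
  rw [hI.measureReal_inter hD hsub, if_neg h, mul_zero]

end Walk

/-! ### A dominating measure for the law of the chain -/

section Density

variable {V : Type*} [Fintype V] [DecidableEq V] (G : SimpleGraph V) [DecidableRel G.Adj]
  (w : ℕ → ℝ) (ℓ₀ : Sym2 V → ℕ)

/-- The factor contributed by the edge `e` with count `k` to the invariant measure of the walk on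
pairs of a position and edge counts. -/
noncomputable def edgeDensity (e : Sym2 V) (k : ℕ) : ℝ :=
  if e ∈ G.edgeFinset then (w k)⁻¹ else if k = ℓ₀ e then 1 else 0

variable {G w ℓ₀}

lemma edgeDensity_nonneg (hw : ∀ k, 0 < w k) (e : Sym2 V) (k : ℕ) :
    0 ≤ edgeDensity G w ℓ₀ e k := by
  have := hw k
  unfold edgeDensity; split_ifs <;> positivity

lemma weight_mul_prod_edgeDensity (hw : ∀ k, 0 < w k) {e : Sym2 V} (he : e ∈ G.edgeFinset)
    (n : Sym2 V → ℕ) :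
    w (n e) * ∏ g, edgeDensity G w ℓ₀ g (n g) =
      ∏ g ∈ Finset.univ.erase e, edgeDensity G w ℓ₀ g (n g) := by
  rw [← Finset.mul_prod_erase _ _ (Finset.mem_univ e), ← mul_assoc]
  rw [edgeDensity, if_pos he, mul_inv_cancel₀ (hw _).ne', one_mul]

lemma prod_erase_edgeDensity_add_single {e : Sym2 V} (n : Sym2 V → ℕ) (k : ℕ) :
    ∏ g ∈ Finset.univ.erase e, edgeDensity G w ℓ₀ g ((n + Pi.single e k : Sym2 V → ℕ) g) =
      ∏ g ∈ Finset.univ.erase e, edgeDensity G w ℓ₀ g (n g) := by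
  refine Finset.prod_congr rfl fun g hg => ?_
  have : g ≠ e := by simpa using hg
  simp [this]

end Density

section Walk

variable {V : Type*} [Fintype V] [DecidableEq V] [MeasurableSpace V] [DiscreteMeasurableSpace V]
variable {Ω : Type*} [MeasurableSpace Ω]
variable {G : SimpleGraph V} [DecidableRel G.Adj] {w : ℕ → ℝ} {ℓ₀ : Sym2 V → ℕ} {v₀ : V}
  {P : Measure Ω} {I : ℕ → Ω → V} [IsProbabilityMeasure P]

/-- Induction on time. A step along `e` multiplies the mass by `w (n e) / W_z(n)`; this removes the
factor of `e` from the product, and what remains does not see that the count of `e` increases.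
Rewritten in terms of the new counts, the incoming masses add up to the total weight at the new
vertex. The indicator factors of non-edges are never altered, and they keep the measure summable
over all counts on `Sym2 V`. `C` normalizes the initial state. -/
lemma IsERRW.measureReal_stateSet_le (hI : IsERRW G w ℓ₀ v₀ P I) (hw : ∀ k, 0 < w k)
    (hv : ∃ y, G.Adj v₀ y) :
    ∃ C : ℝ, 0 ≤ C ∧ ∀ t x n, P.real (stateSet ℓ₀ I t x n) ≤
      C * (vertexWeight G w n x * ∏ g, edgeDensity G w ℓ₀ g (n g)) := by
  obtain ⟨y₀, hy₀⟩ := hv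
  have hWpos : 0 < vertexWeight G w ℓ₀ v₀ := vertexWeight_pos hw hy₀ _
  have hupos : 0 < ∏ g, edgeDensity G w ℓ₀ g (ℓ₀ g) := by
    refine Finset.prod_pos fun g _ => ?_
    have := hw (ℓ₀ g)
    unfold edgeDensity; split_ifs <;> first | positivity | simp_all
  have hu0 : ∀ n : Sym2 V → ℕ, 0 ≤ ∏ g, edgeDensity G w ℓ₀ g (n g) := fun n =>
    Finset.prod_nonneg fun g _ => edgeDensity_nonneg hw _ _
  have hW0 : ∀ n x, 0 ≤ vertexWeight G w n x := fun n x => Finset.sum_nonneg fun _ _ => (hw _).le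
  set C : ℝ := (vertexWeight G w ℓ₀ v₀ * ∏ g, edgeDensity G w ℓ₀ g (ℓ₀ g))⁻¹ with hC
  have hC0 : 0 ≤ C := by positivity
  refine ⟨C, hC0, fun t => ?_⟩
  induction t with
  | zero =>
    intro x n
    by_cases h : x = v₀ ∧ n = ℓ₀
    · obtain ⟨rfl, rfl⟩ := h
      rw [hC, inv_mul_cancel₀ (by positivity)]
      exact measureReal_le_one
    · refine le_trans (le_of_eq ?_) (mul_nonneg hC0 (mul_nonneg (hW0 _ _) (hu0 _)))
      rw [measureReal_eq_zero_iff]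
      refine measure_mono_null (t := {ω | ¬ I 0 ω = v₀}) ?_ hI.initial
      rintro ω ⟨h1, h2⟩ h3
      rw [edgeWeight_zero] at h2
      exact h ⟨h1.symm.trans h3, h2.symm⟩
  | succ t ih =>
    intro y n
    let A : V → Set Ω := fun z => stateSet ℓ₀ I (t + 1) y n ∩ {ω | I t ω = z}
    have hA : stateSet ℓ₀ I (t + 1) y n = ⋃ z, A z := by
      ext ω; simp [A]
    have hAle : ∀ z, P.real (A z) ≤
        if G.Adj y z then C * (w (n s(y, z)) * ∏ g, edgeDensity G w ℓ₀ g (n g)) else 0 := by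
      intro z
      have hrhs : 0 ≤ if G.Adj y z then
          C * (w (n s(y, z)) * ∏ g, edgeDensity G w ℓ₀ g (n g)) else 0 := by
        split_ifs
        · exact mul_nonneg hC0 (mul_nonneg (hw _).le (hu0 _))
        · exact le_rfl
      rcases (A z).eq_empty_or_nonempty with he | ⟨ω₀, ⟨h1, h2⟩, h3⟩
      · rw [he]; simpa using hrhs
      change I t ω₀ = z at h3
      -- The previous counts are `n` with the last traversal removed, so all points of `A z` share
      -- the predecessor `(z, m)`.
      rw [edgeWeight_succ, h1, h3] at h2
      set m := edgeWeight ℓ₀ (fun i => I i ω₀) t with hm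
      have hsub : A z ⊆ stateSet ℓ₀ I t z m ∩ {ω | I (t + 1) ω = y} := by
        rintro ω ⟨⟨h4, h5⟩, h6⟩
        change I t ω = z at h6
        refine ⟨⟨h6, ?_⟩, h4⟩
        rw [edgeWeight_succ, h4, h6, ← h2] at h5
        exact add_right_cancel h5
      refine (measureReal_mono hsub).trans ?_
      by_cases hadj : G.Adj y z
      · have he : s(z, y) ∈ G.edgeFinset := by simpa using hadj.symm
        rw [if_pos hadj, hI.measureReal_inter_of_adj (measurableSet_stateSet t z m) subset_rfl
          hadj.symm, Sym2.eq_swap (a := y), weight_mul_prod_edgeDensity hw he, ← h2,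
          prod_erase_edgeDensity_add_single, ← weight_mul_prod_edgeDensity hw he]
        have hWz := vertexWeight_pos hw hadj.symm m
        refine (mul_le_mul_of_nonneg_right (ih z m) (div_nonneg (hw _).le hWz.le)).trans
          (le_of_eq ?_)
        field_simp
      · rw [if_neg hadj, hI.measureReal_inter_of_not_adj (measurableSet_stateSet t z m) subset_rfl
          fun h => hadj h.symm]
    rw [hA]
    refine (measureReal_iUnion_fintype_le _).trans ((Finset.sum_le_sum fun z _ => hAle z).trans
      (le_of_eq ?_))
    rw [← Finset.sum_filter, ← Finset.mul_sum, ← Finset.sum_mul, vertexWeight,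
      SimpleGraph.neighborFinset_eq_filter]

/-- The event that the walk is at `z` after `t` steps with edge counts `n`, and then alternates
between `x` and `y` for `L` steps, starting at `x`. -/
def alternatingSet (ℓ₀ : Sym2 V → ℕ) (I : ℕ → Ω → V) (t : ℕ) (z : V) (n : Sym2 V → ℕ) (x y : V)
    (L : ℕ) : Set Ω :=
  stateSet ℓ₀ I t z n ∩ {ω | ∀ i ≤ L, I (t + 1 + i) ω = if Even i then x else y}

lemma alternatingSet_zero (t : ℕ) (z : V) (n : Sym2 V → ℕ) (x y : V) :
    alternatingSet ℓ₀ I t z n x y 0 = stateSet ℓ₀ I t z n ∩ {ω | I (t + 1) ω = x} := by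
  ext ω; simp [alternatingSet]

lemma alternatingSet_succ (t : ℕ) (z : V) (n : Sym2 V → ℕ) (x y : V) (L : ℕ) :
    alternatingSet ℓ₀ I t z n x y (L + 1) = alternatingSet ℓ₀ I t z n x y L ∩
      {ω | I (t + 1 + L + 1) ω = if Even (L + 1) then x else y} := by
  ext ω
  simp only [alternatingSet, Set.mem_inter_iff, and_assoc]
  refine and_congr_right fun _ => ⟨fun h => ⟨fun i hi => h i (by omega), h (L + 1) le_rfl⟩,
    fun h i hi => ?_⟩
  rcases hi.lt_or_eq with h' | rfl
  · exact h.1 i (by omega)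
  · exact h.2

lemma alternatingSet_subset_stateSet (t : ℕ) (z : V) (n : Sym2 V → ℕ) (x y : V) (L : ℕ) :
    alternatingSet ℓ₀ I t z n x y L ⊆ stateSet ℓ₀ I (t + 1 + L) (if Even L then x else y)
      (n + Pi.single s(z, x) 1 + Pi.single s(x, y) L) := by
  induction L with
  | zero =>
    rw [alternatingSet_zero]
    simpa using stateSet_inter_subset (ℓ₀ := ℓ₀) (I := I) t z x n
  | succ L ih =>
    rw [alternatingSet_succ]
    refine (Set.inter_subset_inter_left _ ih).trans ((stateSet_inter_subset _ _ _ _).trans ?_)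
    have : s(if Even L then x else y, if Even (L + 1) then x else y) = s(x, y) := by
      by_cases h : Even L
      · rw [if_pos h, if_neg (by simpa [Nat.even_add_one] using h)]
      · rw [if_neg h, if_pos (by simpa [Nat.even_add_one] using h), Sym2.eq_swap]
    have h' : (Pi.single s(x, y) (L + 1) : Sym2 V → ℕ) =
        Pi.single s(x, y) L + Pi.single s(x, y) 1 := Pi.single_add _ _ _
    rw [this, h', ← add_assoc (n + Pi.single s(z, x) 1)]
    exact fun _ h => h

lemma measurableSet_alternatingSet (t : ℕ) (z : V) (n : Sym2 V → ℕ) (x y : V) (L : ℕ) :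
    MeasurableSet[history I (t + 1 + L)] (alternatingSet ℓ₀ I t z n x y L) := by
  induction L with
  | zero =>
    rw [alternatingSet_zero]
    exact (history_mono (by omega) _ (measurableSet_stateSet t z n)).inter
      (measurableSet_history_eq le_rfl x)
  | succ L ih =>
    rw [alternatingSet_succ]
    exact (history_mono (by omega) _ ih).inter (measurableSet_history_eq le_rfl _)

lemma IsERRW.measureReal_alternatingSet_of_not_adj (hI : IsERRW G w ℓ₀ v₀ P I) {t : ℕ} {x y z : V}
    {n : Sym2 V → ℕ} {L : ℕ} (h : ¬ (G.Adj z x ∧ G.Adj x y)) :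
    P.real (alternatingSet ℓ₀ I t z n x y (L + 1)) = 0 := by
  have h1 : P.real (alternatingSet ℓ₀ I t z n x y 1) = 0 := by
    rw [alternatingSet_succ]
    by_cases hzx : G.Adj z x
    · refine hI.measureReal_inter_of_not_adj (measurableSet_alternatingSet t z n x y 0)
        (alternatingSet_subset_stateSet t z n x y 0) ?_
      simpa [hzx] using h
    · refine le_antisymm ((measureReal_mono Set.inter_subset_left).trans (le_of_eq ?_))
        measureReal_nonneg
      rw [alternatingSet_zero]
      exact hI.measureReal_inter_of_not_adj (measurableSet_stateSet t z n) subset_rfl hzx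
  refine le_antisymm ((measureReal_mono ?_).trans h1.le) measureReal_nonneg
  exact Set.inter_subset_inter_right _ fun ω hω i hi => hω i (by omega)

/-- Only the departures from `x` cost anything. At the `j`-th one the edge to `y` has count `a + 2 *
j` and competes at least with the edge back to `z`, whose count is frozen at `b + 1`. Returns from
`y` are bounded by probability one. The arrival at `x` cancels the density factor of the edge from
`z`. -/
lemma IsERRW.measureReal_alternatingSet_le (hI : IsERRW G w ℓ₀ v₀ P I) (hw : ∀ k, 0 < w k)
    {C : ℝ} (hC : ∀ t x n, P.real (stateSet ℓ₀ I t x n) ≤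
      C * (vertexWeight G w n x * ∏ g, edgeDensity G w ℓ₀ g (n g)))
    {x y z : V} (hzx : G.Adj z x) (hxy : G.Adj x y) (hyz : y ≠ z) (t : ℕ) (n : Sym2 V → ℕ)
    (K : ℕ) :
    P.real (alternatingSet ℓ₀ I t z n x y (2 * K + 1)) ≤
      C * ((∏ g ∈ (Finset.univ.erase s(z, x)).erase s(x, y), edgeDensity G w ℓ₀ g (n g)) *
        ((w (n s(x, y)))⁻¹ * ∏ j ∈ Finset.range (K + 1), w (n s(x, y) + 2 * j) /
          (w (n s(x, y) + 2 * j) + w (n s(z, x) + 1)))) := by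
  have hne : s(x, y) ≠ s(z, x) := by
    rw [Sym2.eq_swap (a := z)]
    intro h
    exact hyz (Sym2.congr_right.1 h)
  have hstep : ∀ j, P.real (alternatingSet ℓ₀ I t z n x y (2 * j + 1)) ≤
      P.real (alternatingSet ℓ₀ I t z n x y (2 * j)) * (w (n s(x, y) + 2 * j) /
          (w (n s(x, y) + 2 * j) + w (n s(z, x) + 1))) := by
    intro j
    have hsub := alternatingSet_subset_stateSet (ℓ₀ := ℓ₀) (I := I) t z n x y (2 * j)
    rw [if_pos (by simp)] at hsub
    rw [alternatingSet_succ, if_neg (by simp),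
      hI.measureReal_inter_of_adj (measurableSet_alternatingSet t z n x y _) hsub hxy]
    refine mul_le_mul_of_nonneg_left ?_ measureReal_nonneg
    -- Of the total weight at `x`, only the edges to `y` and to `z` are kept; they are distinct
    -- because `y ≠ z`.
    have h1 := add_le_vertexWeight hw hxy hzx.symm hyz
      (n + Pi.single s(z, x) 1 + Pi.single s(x, y) (2 * j))
    rw [Sym2.eq_swap (a := x) (b := z)] at h1
    simp only [Pi.add_apply, Pi.single_eq_same, Pi.single_eq_of_ne hne,
      Pi.single_eq_of_ne hne.symm, add_zero] at h1 ⊢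
    have := hw (n s(x, y) + 2 * j)
    have := hw (n s(z, x) + 1)
    gcongr
  have hmono : ∀ j, P.real (alternatingSet ℓ₀ I t z n x y (j + 1)) ≤
      P.real (alternatingSet ℓ₀ I t z n x y j) := fun j => by
    rw [alternatingSet_succ]; exact measureReal_mono Set.inter_subset_left
  have hfac : ∀ j, 0 ≤ w (n s(x, y) + 2 * j) /
      (w (n s(x, y) + 2 * j) + w (n s(z, x) + 1)) := fun j =>
    div_nonneg (hw _).le (add_pos (hw _) (hw _)).le
  have hprod : P.real (alternatingSet ℓ₀ I t z n x y (2 * K + 1)) ≤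
      P.real (alternatingSet ℓ₀ I t z n x y 0) * ∏ j ∈ Finset.range (K + 1),
        w (n s(x, y) + 2 * j) / (w (n s(x, y) + 2 * j) + w (n s(z, x) + 1)) := by
    induction K with
    | zero => simpa using hstep 0
    | succ K ih =>
      rw [Finset.prod_range_succ, ← mul_assoc]
      refine (hstep _).trans (mul_le_mul_of_nonneg_right ((hmono _).trans ih) (hfac _))
  refine hprod.trans ?_
  rw [← mul_assoc, ← mul_assoc]
  refine mul_le_mul_of_nonneg_right ?_ (Finset.prod_nonneg fun j _ => hfac j)
  have hf : s(z, x) ∈ G.edgeFinset := by simpa using hzx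
  have he : s(x, y) ∈ G.edgeFinset := by simpa using hxy
  have hWz := vertexWeight_pos hw hzx n
  rw [alternatingSet_zero, hI.measureReal_inter_of_adj (measurableSet_stateSet t z n) subset_rfl
    hzx]
  refine (mul_le_mul_of_nonneg_right (hC t z n) (div_nonneg (hw _).le hWz.le)).trans
    (le_of_eq ?_)
  have h1 := weight_mul_prod_edgeDensity (ℓ₀ := ℓ₀) hw hf n
  rw [← Finset.mul_prod_erase (Finset.univ.erase s(z, x)) _
    (Finset.mem_erase.2 ⟨hne, Finset.mem_univ s(x, y)⟩)] at h1
  have h2 : edgeDensity G w ℓ₀ s(x, y) (n s(x, y)) = (w (n s(x, y)))⁻¹ := by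
    rw [edgeDensity, if_pos he]
  rw [h2] at h1
  calc _ = C * (w (n s(z, x)) * ∏ g, edgeDensity G w ℓ₀ g (n g)) := by field_simp
    _ = _ := by rw [h1]; ring

end Walk

/-! ### Sums over edge counts of products over edges -/

lemma one_add_sum_le_prod {ι : Type*} (s : Finset ι) (n : ι → ℕ) :
    1 + ∑ i ∈ s, n i ≤ ∏ i ∈ s, (1 + n i) := by
  classical
  induction s using Finset.induction_on with
  | empty => simp
  | insert a s ha ih =>
    rw [Finset.sum_insert ha, Finset.prod_insert ha]
    refine le_trans ?_ (Nat.mul_le_mul_left _ ih)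
    nlinarith [Nat.zero_le (n a * ∑ i ∈ s, n i)]

lemma tsum_prod_pi_le {ι : Type*} [Fintype ι] [DecidableEq ι] (f : ι → ℕ → ℝ≥0∞) :
    ∑' n : ι → ℕ, ∏ i, f i (n i) ≤ ∏ i, ∑' k, f i k := by
  rw [ENNReal.tsum_eq_iSup_sum]
  refine iSup_le fun F => ?_
  have hsub : F ⊆ Fintype.piFinset fun i => F.image fun n => n i := by
    intro n hn
    simp only [Fintype.mem_piFinset, Finset.mem_image]
    exact fun i => ⟨n, hn, rfl⟩
  calc ∑ n ∈ F, ∏ i, f i (n i)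
      ≤ ∑ n ∈ Fintype.piFinset fun i => F.image fun n => n i, ∏ i, f i (n i) :=
        Finset.sum_le_sum_of_subset hsub
    _ = ∏ i, ∑ k ∈ F.image fun n => n i, f i k := (Finset.prod_univ_sum _ _).symm
    _ ≤ ∏ i, ∑' k, f i k := Finset.prod_le_prod' fun i _ => ENNReal.sum_le_tsum _

/-- The coordinates `e` and `f` are coupled through `r`. Pinning them to values `a` and `b` by
indicators turns the summand into a full product, whose sum over the remaining coordinates is
bounded uniformly in `a` and `b`. -/
lemma tsum_prod_erase_mul_ne_top {ι : Type*} [Fintype ι] [DecidableEq ι] {e f : ι} (hef : e ≠ f)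
    {U : ι → ℕ → ℝ≥0∞} (hU : ∀ g, ∑' k, U g k ≠ ⊤) {r : ℕ → ℕ → ℝ≥0∞}
    (hr : ∑' a, ∑' b, r a b ≠ ⊤) :
    ∑' n : ι → ℕ, (∏ g ∈ (Finset.univ.erase f).erase e, U g (n g)) * r (n e) (n f) ≠ ⊤ := by
  let q : ℕ → ℕ → ι → ℕ → ℝ≥0∞ := fun a b g k =>
    if g = e then (if k = a then 1 else 0) else if g = f then (if k = b then 1 else 0) else U g k
  have hq : ∀ a b (n : ι → ℕ), ∏ g, q a b g (n g) =
      (if n e = a then 1 else 0) * ((if n f = b then 1 else 0) *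
        ∏ g ∈ (Finset.univ.erase f).erase e, U g (n g)) := by
    intro a b n
    rw [← Finset.mul_prod_erase _ _ (Finset.mem_univ f),
      ← Finset.mul_prod_erase (Finset.univ.erase f) _
        (Finset.mem_erase.2 ⟨hef, Finset.mem_univ e⟩), mul_left_comm]
    congr 1
    · simp [q]
    congr 1
    · simp [q, hef.symm]
    refine Finset.prod_congr rfl fun g hg => ?_
    simp only [Finset.mem_erase, Finset.mem_univ, and_true] at hg
    simp [q, hg.1, hg.2]
  -- The factor `1 + ∑' k, U g k` dominates both the pinned coordinates, which sum to `1`, and the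
  -- free ones.
  have hqs : ∀ a b, ∑' n : ι → ℕ, ∏ g, q a b g (n g) ≤ ∏ g, (1 + ∑' k, U g k) := by
    intro a b
    refine (tsum_prod_pi_le _).trans (Finset.prod_le_prod' fun g _ => ?_)
    by_cases h1 : g = e
    · simp [q, h1]
    by_cases h2 : g = f
    · simp [q, h2, hef.symm]
    simp [q, h1, h2]
  have hle : ∑' n : ι → ℕ, (∏ g ∈ (Finset.univ.erase f).erase e, U g (n g)) * r (n e) (n f) ≤
      (∑' a, ∑' b, r a b) * ∏ g, (1 + ∑' k, U g k) := by
    calc _ = ∑' n : ι → ℕ, ∑' a, ∑' b, r a b * ∏ g, q a b g (n g) := by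
          refine tsum_congr fun n => ?_
          rw [tsum_eq_single (n e), tsum_eq_single (n f), hq]
          · simp [mul_comm]
          · intro b hb; simp [hq, hb.symm]
          · intro a ha; simp [hq, ha.symm]
      _ = ∑' a, ∑' b, ∑' n : ι → ℕ, r a b * ∏ g, q a b g (n g) := by
          rw [ENNReal.tsum_comm]
          exact tsum_congr fun a => ENNReal.tsum_comm
      _ ≤ ∑' a, ∑' b, r a b * ∏ g, (1 + ∑' k, U g k) := by
          refine ENNReal.tsum_le_tsum fun a => ENNReal.tsum_le_tsum fun b => ?_
          rw [ENNReal.tsum_mul_left]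
          gcongr
          exact hqs a b
      _ = _ := by simp_rw [ENNReal.tsum_mul_right]
  refine ne_top_of_le_ne_top (ENNReal.mul_ne_top hr ?_) hle
  exact ENNReal.prod_ne_top fun g _ => ENNReal.add_ne_top.2 ⟨by simp, hU g⟩

/-! ### Edge switches and the finiteness criterion -/

section Walk

variable {V : Type*} [Fintype V] [DecidableEq V] [MeasurableSpace V] [DiscreteMeasurableSpace V]
variable {Ω : Type*} [MeasurableSpace Ω]
variable {G : SimpleGraph V} [DecidableRel G.Adj] {w : ℕ → ℝ} {ℓ₀ : Sym2 V → ℕ} {v₀ : V}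
  {P : Measure Ω} {I : ℕ → Ω → V}

lemma tsum_mul_measure_iUnion_ne_top {e f : Sym2 V} (hef : e ≠ f) {z : V}
    {U : Sym2 V → ℕ → ℝ≥0∞} (hU : ∀ g, ∑' k, U g k ≠ ⊤) {r : ℕ → ℕ → ℝ≥0∞}
    (hr : ∑' a, ∑' b, r a b ≠ ⊤) {C : ℝ≥0∞} (hC : C ≠ ⊤) {ψ : ℕ → ℝ≥0∞}
    {A : ℕ → (Sym2 V → ℕ) → Set Ω} (hA : ∀ m n, A m n ⊆ stateSet ℓ₀ I m z n)
    (hb : ∀ m n, m ≤ ∑ g, n g → ψ m * P (A m n) ≤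
      C * ((∏ g ∈ (Finset.univ.erase f).erase e, U g (n g)) * r (n e) (n f))) :
    ∑' m, ψ m * P (⋃ n, A m n) ≠ ⊤ := by
  refine ne_top_of_le_ne_top (ENNReal.mul_ne_top hC (tsum_prod_erase_mul_ne_top hef hU hr)) ?_
  calc ∑' m, ψ m * P (⋃ n, A m n) ≤ ∑' m, ∑' n, ψ m * P (A m n) := by
        refine ENNReal.tsum_le_tsum fun m => ?_
        rw [ENNReal.tsum_mul_left]
        gcongr
        exact measure_iUnion_le _
    _ = ∑' n, ∑' m, ψ m * P (A m n) := ENNReal.tsum_comm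
    _ ≤ ∑' n : Sym2 V → ℕ,
        C * ((∏ g ∈ (Finset.univ.erase f).erase e, U g (n g)) * r (n e) (n f)) := by
        refine ENNReal.tsum_le_tsum fun n => ?_
        have hm : ∀ m, m + ∑ g, ℓ₀ g ≠ ∑ g, n g → A m n = ∅ := by
          intro m hne
          refine Set.eq_empty_of_forall_notMem fun ω hω => hne ?_
          rw [← (hA m n hω).2, sum_edgeWeight]
        -- For given counts only this time can contribute. If the truncated subtraction gives a
        -- spurious `0`, the bound `hb` still applies there.
        rw [tsum_eq_single (∑ g, n g - ∑ g, ℓ₀ g)]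
        · exact hb _ _ (Nat.sub_le _ _)
        · intro m hne
          rw [hm m (by omega)]; simp
    _ = _ := ENNReal.tsum_mul_left

/-- The weight function seen by a walk that arrives at a vertex along an edge whose count thereby
becomes `b + 1`, and then crosses `K + 1` times an edge of count `a` back and forth. -/
noncomputable def stickWeight (w : ℕ → ℝ) (K a b : ℕ) : ℝ :=
  (w a)⁻¹ * ∏ j ∈ Finset.range (K + 1), w (a + 2 * j) / (w (a + 2 * j) + w (b + 1))

lemma stickWeight_nonneg (hw : ∀ k, 0 < w k) (K a b : ℕ) : 0 ≤ stickWeight w K a b :=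
  mul_nonneg (inv_nonneg.2 (hw _).le) (Finset.prod_nonneg fun _ _ =>
    div_nonneg (hw _).le (add_pos (hw _) (hw _)).le)

variable [IsProbabilityMeasure P]

/-- The time weight `ψ m` is split multiplicatively: the two edges at the switch receive `φ`, and
every other edge `g` a factor `1 + n g`, absorbed by `hsum`. -/
lemma IsERRW.tsum_mul_measure_ne_top (hI : IsERRW G w ℓ₀ v₀ P I) (hw : ∀ k, 0 < w k)
    (hv : ∃ y, G.Adj v₀ y) (hsum : ∑' k : ℕ, ENNReal.ofReal ((1 + k) * (w k)⁻¹) ≠ ⊤)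
    {ψ : ℕ → ℕ} {φ : ℕ → ℕ → ℕ} {K : ℕ → ℕ → ℕ}
    (hr : ∑' a, ∑' b, ENNReal.ofReal (φ a b * stickWeight w (K a b) a b) ≠ ⊤)
    (hφ : ∀ (e f : Sym2 V) (n : Sym2 V → ℕ) (m : ℕ), e ≠ f → m ≤ ∑ g, n g →
      ψ m ≤ φ (n e) (n f) * ∏ g ∈ (Finset.univ.erase f).erase e, (1 + n g))
    {A : ℕ → Set Ω}
    (hA : ∀ m, ∀ ω ∈ A m, ∃ z x y n, y ≠ z ∧
      ω ∈ alternatingSet ℓ₀ I m z n x y (2 * K (n s(x, y)) (n s(z, x)) + 1)) :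
    ∑' m, (ψ m : ℝ≥0∞) * P (A m) ≠ ⊤ := by
  obtain ⟨C, hC0, hC⟩ := hI.measureReal_stateSet_le hw hv
  let B : V × V × V → ℕ → (Sym2 V → ℕ) → Set Ω := fun p m n =>
    {ω | p.2.2 ≠ p.1 ∧ G.Adj p.1 p.2.1 ∧ G.Adj p.2.1 p.2.2} ∩
    alternatingSet ℓ₀ I m p.1 n p.2.1 p.2.2
      (2 * K (n s(p.2.1, p.2.2)) (n s(p.1, p.2.1)) + 1)
  let U : Sym2 V → ℕ → ℝ≥0∞ := fun g k => (1 + k) * ENNReal.ofReal (edgeDensity G w ℓ₀ g k)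
  have hU : ∀ g, ∑' k, U g k ≠ ⊤ := by
    intro g
    by_cases hg : g ∈ G.edgeFinset
    · refine ne_of_eq_of_ne (tsum_congr fun k => ?_) hsum
      rw [ENNReal.ofReal_mul (by positivity), ENNReal.ofReal_add (by positivity) (by positivity)]
      have hgk : edgeDensity G w ℓ₀ g k = (w k)⁻¹ := if_pos hg
      simp [U, hgk]
    · rw [tsum_eq_single (ℓ₀ g)]
      · exact ENNReal.mul_ne_top (by simp) (by simp)
      · intro k hk; simp only [U, edgeDensity, if_neg hg, if_neg hk]; simp
  have hAB : ∀ m, P (A m) ≤ ∑ p, P (⋃ n, B p m n) := by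
    intro m
    -- Configurations in which a prescribed step is not along an edge of `G` form a null set, so
    -- adjacency can be assumed afterwards.
    let N : Set Ω := ⋃ (p : V × V × V) (n : Sym2 V → ℕ)
        (_ : ¬ (G.Adj p.1 p.2.1 ∧ G.Adj p.2.1 p.2.2)),
        alternatingSet ℓ₀ I m p.1 n p.2.1 p.2.2
          (2 * K (n s(p.2.1, p.2.2)) (n s(p.1, p.2.1)) + 1)
    have hnull : P N = 0 := by
      refine measure_iUnion_null fun p => measure_iUnion_null fun n => measure_iUnion_null fun h => ?_
      have := hI.measureReal_alternatingSet_of_not_adj (t := m) (n := n)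
        (L := 2 * K (n s(p.2.1, p.2.2)) (n s(p.1, p.2.1))) h
      rwa [measureReal_eq_zero_iff] at this
    calc P (A m) ≤ P ((⋃ p, ⋃ n, B p m n) ∪ N) := by
          refine measure_mono fun ω hω => ?_
          obtain ⟨z, x, y, n, hyz, hω'⟩ := hA m ω hω
          by_cases h : G.Adj z x ∧ G.Adj x y
          · refine Or.inl ?_
            simp only [Set.mem_iUnion]
            exact ⟨(z, x, y), n, ⟨hyz, h⟩, hω'⟩
          · refine Or.inr ?_
            simp only [N, Set.mem_iUnion]
            exact ⟨(z, x, y), n, h, hω'⟩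
      _ ≤ P (⋃ p, ⋃ n, B p m n) + 0 := (measure_union_le _ _).trans (by rw [hnull])
      _ ≤ _ := by rw [add_zero]; exact measure_iUnion_fintype_le _ _
  have hle : ∑' m, (ψ m : ℝ≥0∞) * P (A m) ≤ ∑ p, ∑' m, (ψ m : ℝ≥0∞) * P (⋃ n, B p m n) := by
    rw [← Summable.tsum_finsetSum fun _ _ => ENNReal.summable]
    refine ENNReal.tsum_le_tsum fun m => ?_
    rw [← Finset.mul_sum]
    gcongr
    exact hAB m
  refine ne_top_of_le_ne_top (ENNReal.sum_ne_top.2 fun p _ => ?_) hle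
  obtain ⟨z, x, y⟩ := p
  by_cases hp : y ≠ z ∧ G.Adj z x ∧ G.Adj x y
  swap
  · have : ∀ m n, B (z, x, y) m n = ∅ := fun m n =>
      Set.eq_empty_of_forall_notMem fun ω hω => hp hω.1
    simp [this]
  obtain ⟨hyz, hzx, hxy⟩ := hp
  have hne : s(x, y) ≠ s(z, x) := by
    rw [Sym2.eq_swap (a := z)]
    intro h
    exact hyz (Sym2.congr_right.1 h)
  refine tsum_mul_measure_iUnion_ne_top (I := I) (ℓ₀ := ℓ₀) (z := z) hne hU hr
    (C := ENNReal.ofReal C) (by simp)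
    (fun m n ω hω => hω.2.1) fun m n hmn => ?_
  have h1 : P (B (z, x, y) m n) ≤ ENNReal.ofReal
      (C * ((∏ g ∈ (Finset.univ.erase s(z, x)).erase s(x, y), edgeDensity G w ℓ₀ g (n g)) *
        stickWeight w (K (n s(x, y)) (n s(z, x))) (n s(x, y)) (n s(z, x)))) := by
    refine (measure_mono Set.inter_subset_right).trans ?_
    rw [← ofReal_measureReal]
    exact ENNReal.ofReal_le_ofReal
      (hI.measureReal_alternatingSet_le hw hC hzx hxy hyz m n _)
  rw [ENNReal.ofReal_mul hC0, ENNReal.ofReal_mul (Finset.prod_nonneg fun g _ =>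
    edgeDensity_nonneg hw _ _), ENNReal.ofReal_prod_of_nonneg fun g _ =>
    edgeDensity_nonneg hw _ _] at h1
  have h2 : (ψ m : ℝ≥0∞) ≤ φ (n s(x, y)) (n s(z, x)) *
      ∏ g ∈ (Finset.univ.erase s(z, x)).erase s(x, y), (1 + (n g : ℝ≥0∞)) := by
    exact_mod_cast hφ _ _ n m hne hmn
  refine (mul_le_mul' h2 h1).trans (le_of_eq ?_)
  simp only [U]
  rw [Finset.prod_mul_distrib, ENNReal.ofReal_mul (by positivity), ENNReal.ofReal_natCast]
  ring

/-- The event that the edges crossed at steps `m` and `m + 1` differ. -/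
def switchSet (I : ℕ → Ω → V) (m : ℕ) : Set Ω :=
  {ω | s(I m ω, I (m + 1) ω) ≠ s(I (m + 1) ω, I (m + 2) ω)}

/-- The event that the last change of the crossed edge happens at step `m`. -/
def lastSwitchSet (I : ℕ → Ω → V) (m : ℕ) : Set Ω :=
  switchSet I m ∩ {ω | ∀ k, m < k → ω ∉ switchSet I k}

lemma measurableSet_switchSet (hI : IsERRW G w ℓ₀ v₀ P I) (m : ℕ) :
    MeasurableSet (switchSet I m) := by
  have : switchSet I m = ⋃ (a : V) (b : V) (c : V) (_ : s(a, b) ≠ s(b, c)),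
      (I m ⁻¹' {a} ∩ I (m + 1) ⁻¹' {b} ∩ I (m + 2) ⁻¹' {c}) := by
    ext ω; simp [switchSet]
  rw [this]
  refine MeasurableSet.iUnion fun a => MeasurableSet.iUnion fun b => MeasurableSet.iUnion fun c =>
    MeasurableSet.iUnion fun _ => ?_
  exact ((hI.measurable _ (measurableSet_singleton _)).inter
    (hI.measurable _ (measurableSet_singleton _))).inter
    (hI.measurable _ (measurableSet_singleton _))

lemma measurableSet_lastSwitchSet (hI : IsERRW G w ℓ₀ v₀ P I) (m : ℕ) :
    MeasurableSet (lastSwitchSet I m) := by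
  have : lastSwitchSet I m = switchSet I m ∩ ⋂ (k) (_ : m < k), (switchSet I k)ᶜ := by
    ext ω; simp [lastSwitchSet]
  rw [this]
  exact (measurableSet_switchSet hI m).inter (MeasurableSet.iInter fun k =>
    MeasurableSet.iInter fun _ => (measurableSet_switchSet hI k).compl)

/-- Crossing the same edge twice in a row means returning to the vertex left two steps before. -/
lemma mem_alternatingSet_of_mem_switchSet {m L : ℕ} {ω : Ω}
    (h : ∀ k, m < k → k < m + L → ω ∉ switchSet I k) :
    ω ∈ alternatingSet ℓ₀ I m (I m ω) (edgeWeight ℓ₀ (fun i => I i ω) m) (I (m + 1) ω)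
      (I (m + 2) ω) L := by
  refine ⟨⟨rfl, rfl⟩, fun i => ?_⟩
  induction i using Nat.twoStepInduction with
  | zero => simp
  | one => simp
  | more i ih _ =>
    intro hi
    have h1 : s(I (m + 1 + i) ω, I (m + 1 + i + 1) ω) =
        s(I (m + 1 + i + 1) ω, I (m + 1 + i + 2) ω) := by
      by_contra hne
      exact h (m + 1 + i) (by omega) (by omega) hne
    rw [Sym2.eq_swap, Sym2.congr_right] at h1
    have h2 : I (m + 1 + (i + 2)) ω = I (m + 1 + i) ω := h1.symm
    rw [h2, ih (by omega)]
    simp [Nat.even_add_one]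

lemma ne_of_mem_switchSet {m : ℕ} {ω : Ω} (h : ω ∈ switchSet I m) : I (m + 2) ω ≠ I m ω := by
  intro h'
  refine h ?_
  rw [h', Sym2.eq_swap]

lemma attractionTime_le {ω : Ω} (h : ∀ᶠ m in Filter.atTop, ω ∉ switchSet I m) :
    (attractionTime G ℓ₀ (fun n => I n ω) : ℝ≥0∞) ≤
      initialTime G ℓ₀ + ∑' m, (lastSwitchSet I m).indicator (fun _ => ((m + 1 : ℕ) : ℝ≥0∞)) ω := by
  have key : ∀ k : ℕ, (∀ n ≥ k, ω ∉ switchSet I n) →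
      (attractionTime G ℓ₀ (fun n => I n ω) : ℝ≥0∞) ≤ initialTime G ℓ₀ + (k : ℝ≥0∞) := by
    intro k hk
    have h1 : attractionTime G ℓ₀ (fun n => I n ω) ≤ (initialTime G ℓ₀ : ℕ∞) + (k : ℕ∞) := by
      unfold attractionTime
      gcongr
      refine iInf₂_le k fun n hn => ?_
      by_contra hne
      exact hk n hn hne
    have h2 := ENat.toENNReal_le.2 h1
    simpa using h2
  obtain ⟨M, hM⟩ := Filter.eventually_atTop.1 h
  by_cases hne : ∃ m, ω ∈ switchSet I m
  · have hb : ∀ m, ω ∈ switchSet I m → m ≤ M := fun m hm => by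
      by_contra hlt
      exact hM m (by omega) hm
    classical
    set m := Nat.findGreatest (fun m => ω ∈ switchSet I m) M with hmdef
    obtain ⟨m', hm'⟩ := hne
    have hm : ω ∈ switchSet I m := Nat.findGreatest_spec (P := fun m => ω ∈ switchSet I m)
      (hb m' hm') hm'
    have hmax : ∀ k, m < k → ω ∉ switchSet I k := fun k hk hk' =>
      Nat.findGreatest_is_greatest hk (hb k hk') hk'
    refine (key (m + 1) fun n hn => hmax n (by omega)).trans ?_
    gcongr
    refine le_trans ?_ (ENNReal.le_tsum m)
    rw [Set.indicator_of_mem (show ω ∈ lastSwitchSet I m from ⟨hm, hmax⟩)]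
  · push Not at hne
    refine (key 0 fun n _ => hne n).trans ?_
    gcongr
    simp

/-- `h0` bounds the expected number of switches, so by Borel–Cantelli there is a.s. a last one, if
any. `hK` bounds the mean of its time: after it the walk alternates for ever, in particular for as
many steps as `K` asks. -/
theorem IsERRW.expectedAttractionTime_lt_top (hI : IsERRW G w ℓ₀ v₀ P I) (hw : ∀ k, 0 < w k)
    (hv : ∃ y, G.Adj v₀ y) (hsum : ∑' k : ℕ, ENNReal.ofReal ((1 + k) * (w k)⁻¹) ≠ ⊤)
    (h0 : ∑' a, ∑' b, ENNReal.ofReal (stickWeight w 0 a b) ≠ ⊤) {K : ℕ → ℕ → ℕ}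
    (hK : ∑' a : ℕ, ∑' b : ℕ, ENNReal.ofReal ((1 + a + b : ℕ) * stickWeight w (K a b) a b) ≠ ⊤) :
    expectedAttractionTime G ℓ₀ P I < ⊤ := by
  have hfin : ∑' m, P (switchSet I m) ≠ ⊤ := by
    have := hI.tsum_mul_measure_ne_top hw hv hsum (ψ := fun _ => 1) (φ := fun _ _ => 1)
      (K := fun _ _ => 0) (by simpa using h0) (A := switchSet I) ?_ ?_
    · simpa using this
    · intro e f n m _ _
      rw [one_mul]
      exact Finset.one_le_prod' fun g _ => by omega
    · intro m ω hω
      exact ⟨_, _, _, _, ne_of_mem_switchSet hω,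
        mem_alternatingSet_of_mem_switchSet fun k h1 h2 => by omega⟩
  have hlast : ∑' m, ((m + 1 : ℕ) : ℝ≥0∞) * P (lastSwitchSet I m) ≠ ⊤ := by
    refine hI.tsum_mul_measure_ne_top hw hv hsum (ψ := fun m => m + 1)
      (φ := fun a b => 1 + a + b) (K := K) hK ?_ ?_
    · intro e f n m hef hm
      -- This uses `m + 1 ≤ 1 + ∑ n g ≤ (1 + n e + n f) * ∏ (1 + n g)`, the product being over the
      -- other edges.
      rw [← Finset.add_sum_erase _ _ (Finset.mem_univ f), ← Finset.add_sum_erase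
        (Finset.univ.erase f) _ (Finset.mem_erase.2 ⟨hef, Finset.mem_univ e⟩)] at hm
      have h1 : 1 + ∑ g ∈ (Finset.univ.erase f).erase e, n g ≤
          ∏ g ∈ (Finset.univ.erase f).erase e, (1 + n g) :=
        one_add_sum_le_prod _ _
      refine le_trans ?_ (Nat.mul_le_mul_left _ h1)
      nlinarith [Nat.zero_le ((n e + n f) * ∑ g ∈ (Finset.univ.erase f).erase e, n g)]
    · intro m ω hω
      exact ⟨_, _, _, _, ne_of_mem_switchSet hω.1,
        mem_alternatingSet_of_mem_switchSet fun k h1 _ => hω.2 k h1⟩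
  have hae : ∀ᵐ ω ∂P, ∀ᶠ m in Filter.atTop, ω ∉ switchSet I m := ae_eventually_notMem hfin
  have hle : expectedAttractionTime G ℓ₀ P I ≤ initialTime G ℓ₀ +
      ∑' m, ((m + 1 : ℕ) : ℝ≥0∞) * P (lastSwitchSet I m) := by
    calc expectedAttractionTime G ℓ₀ P I ≤ ∫⁻ ω, (initialTime G ℓ₀ +
          ∑' m, (lastSwitchSet I m).indicator (fun _ => ((m + 1 : ℕ) : ℝ≥0∞)) ω) ∂P :=
          lintegral_mono_ae (hae.mono fun ω hω => attractionTime_le hω)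
      _ = _ := by
          rw [lintegral_add_left measurable_const, lintegral_const, measure_univ, mul_one,
            lintegral_tsum fun m => (measurable_const.indicator
              (measurableSet_lastSwitchSet hI m)).aemeasurable]
          congr 1
          exact tsum_congr fun m => lintegral_indicator_const (measurableSet_lastSwitchSet hI m) _
  refine lt_of_le_of_lt hle (ENNReal.add_lt_top.2 ⟨by simp, hlast.lt_top⟩)

end Walk

/-- A weight function comparable with `k ^ ρ * log k ^ α` that is positive and monotone. -/
noncomputable def refWeight (ρ α : ℝ) (k : ℕ) : ℝ := ((k : ℝ) + 2) ^ ρ * Real.log (k + 2) ^ α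

/-! ### Comparison of `w` with a monotone reference weight -/

section RefWeight

lemma log_natCast_add_two_pos (k : ℕ) : 0 < Real.log ((k : ℝ) + 2) :=
  Real.log_pos (by have : (0 : ℝ) ≤ k := by positivity
                   linarith)

lemma log_two_le_log_natCast_add_two (k : ℕ) : Real.log 2 ≤ Real.log ((k : ℝ) + 2) :=
  Real.log_le_log (by norm_num) (by have : (0 : ℝ) ≤ k := by positivity
                                    linarith)

variable {ρ α : ℝ}

lemma refWeight_pos (k : ℕ) : 0 < refWeight ρ α k := by
  have := log_natCast_add_two_pos k
  unfold refWeight; positivity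

lemma refWeight_mono (hρ : 0 ≤ ρ) (hα : 0 ≤ α) : Monotone (refWeight ρ α) := by
  intro a b h
  have := log_natCast_add_two_pos a
  have h' : (a : ℝ) ≤ b := by exact_mod_cast h
  unfold refWeight
  gcongr

/-- Doubling property: enlarging the argument by a factor `c` costs a constant, since `log (c * t) ≤
2 * c * log t` for `t ≥ 2`. -/
lemma refWeight_mul_le (hρ : 0 ≤ ρ) (hα : 0 ≤ α) {c : ℕ} (hc : 1 ≤ c) (k m : ℕ)
    (h : k + 2 ≤ c * (m + 2)) :
    refWeight ρ α k ≤ ((c : ℝ) ^ ρ * (2 * c : ℝ) ^ α) * refWeight ρ α m := by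
  have hm := log_natCast_add_two_pos m
  have hm2 := log_two_le_log_natCast_add_two m
  have hk := log_natCast_add_two_pos k
  have h1 : (k : ℝ) + 2 ≤ c * (m + 2) := by exact_mod_cast h
  have hc' : (1 : ℝ) ≤ c := by exact_mod_cast hc
  have h2 : Real.log ((k : ℝ) + 2) ≤ (2 * c) * Real.log (m + 2) := by
    calc Real.log ((k : ℝ) + 2) ≤ Real.log (c * (m + 2)) := Real.log_le_log (by positivity) h1
      _ = Real.log c + Real.log (m + 2) := Real.log_mul (by positivity) (by positivity)
      _ ≤ (c - 1) + Real.log (m + 2) := by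
          gcongr; exact Real.log_le_sub_one_of_pos (by positivity)
      _ ≤ _ := by
          have := Real.log_two_gt_d9
          nlinarith
  have hm0 : (0 : ℝ) ≤ (m : ℝ) + 2 := by positivity
  calc refWeight ρ α k ≤ (c * ((m : ℝ) + 2)) ^ ρ * ((2 * c) * Real.log (m + 2)) ^ α := by
        unfold refWeight; gcongr
    _ = _ := by
        rw [refWeight, Real.mul_rpow (by positivity) hm0, Real.mul_rpow (by positivity) hm.le]
        ring

lemma exists_comparable_refWeight (hρ : 0 ≤ ρ) (hα : 0 ≤ α) {w : ℕ → ℝ} (hw : ∀ k, 0 < w k)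
    (hwk : ∀ k : ℕ, 2 ≤ k → w k = (k : ℝ) ^ ρ * Real.log k ^ α) :
    ∃ C : ℝ, 1 ≤ C ∧ ∀ k, w k ≤ C * refWeight ρ α k ∧ refWeight ρ α k ≤ C * w k := by
  have key : ∀ k : ℕ, w k / refWeight ρ α k ≤
        max 1 (max (w 0 / refWeight ρ α 0) (w 1 / refWeight ρ α 1)) ∧
      refWeight ρ α k / w k ≤ max ((2 : ℝ) ^ ρ * (4 : ℝ) ^ α)
        (max (refWeight ρ α 0 / w 0) (refWeight ρ α 1 / w 1)) := by
    intro k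
    match k with
    | 0 => simp
    | 1 => simp
    | k + 2 =>
      have h1 : w (k + 2) = refWeight ρ α k := by
        rw [hwk _ (by omega), refWeight]; push_cast; rfl
      rw [h1]
      constructor
      · refine le_max_of_le_left ?_
        rw [div_le_one (refWeight_pos _)]
        exact refWeight_mono hρ hα (by omega)
      · refine le_max_of_le_left ?_
        rw [div_le_iff₀ (refWeight_pos _)]
        have := refWeight_mul_le hρ hα (c := 2) (by norm_num) (k + 2) k (by omega)
        norm_num at this ⊢
        exact this
  refine ⟨max (max 1 (max (w 0 / refWeight ρ α 0) (w 1 / refWeight ρ α 1)))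
    (max ((2 : ℝ) ^ ρ * (4 : ℝ) ^ α) (max (refWeight ρ α 0 / w 0) (refWeight ρ α 1 / w 1))),
    by simp, fun k => ⟨?_, ?_⟩⟩
  · rw [← div_le_iff₀ (refWeight_pos k)]
    exact (key k).1.trans (le_max_left _ _)
  · rw [← div_le_iff₀ (hw k)]
    exact (key k).2.trans (le_max_right _ _)

end RefWeight

/-! ### Convergence of the series of `k ^ (-γ) * log k ^ (-α)` -/

section Series

variable {γ α : ℝ}

lemma summable_condensed_log (hα : 0 ≤ α) :
    (Summable fun n : ℕ => ((n : ℝ) + 2)⁻¹ * Real.log (n + 2) ^ (-α)) ↔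
      Summable fun k : ℕ => (2 : ℝ) ^ k * (((2 ^ k : ℕ) + 2 : ℝ)⁻¹ *
        Real.log ((2 ^ k : ℕ) + 2) ^ (-α)) := by
  refine (summable_condensed_iff_of_nonneg (f := fun n : ℕ => ((n : ℝ) + 2)⁻¹ *
    Real.log (n + 2) ^ (-α)) (fun n => ?_) fun m n _ h => ?_).symm
  · have := log_natCast_add_two_pos n
    positivity
  · have hm := log_natCast_add_two_pos m
    have h' : (m : ℝ) ≤ n := by exact_mod_cast h
    have hlog : Real.log ((m : ℝ) + 2) ≤ Real.log (n + 2) :=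
      Real.log_le_log (by positivity) (by linarith)
    exact mul_le_mul (by gcongr) (Real.rpow_le_rpow_of_nonpos hm hlog (by linarith))
      (Real.rpow_nonneg (hm.le.trans hlog) _) (by positivity)

lemma summable_rpow_mul_log (hα : 0 ≤ α) (h : 1 < γ ∨ γ = 1 ∧ 1 < α) :
    Summable fun k : ℕ => ((k : ℝ) + 2) ^ (-γ) * Real.log (k + 2) ^ (-α) := by
  rcases h with h | ⟨rfl, h⟩
  · have h1 : Summable fun k : ℕ => ((k : ℝ) + 2) ^ (-γ) * Real.log 2 ^ (-α) := by
      refine Summable.mul_right _ ?_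
      have := (summable_nat_add_iff 2).2 (Real.summable_nat_rpow.2 (show -γ < -1 by linarith))
      simpa using this
    refine Summable.of_nonneg_of_le (fun k => ?_) (fun k => ?_) h1
    · have := log_natCast_add_two_pos k
      positivity
    · have := log_two_le_log_natCast_add_two k
      exact mul_le_mul_of_nonneg_left
        (Real.rpow_le_rpow_of_nonpos (Real.log_pos (by norm_num)) this (by linarith))
        (by positivity)
  · simp_rw [Real.rpow_neg_one]
    rw [summable_condensed_log hα]
    have h1 : Summable fun k : ℕ => (k : ℝ) ^ (-α) * Real.log 2 ^ (-α) :=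
      Summable.mul_right _ (Real.summable_nat_rpow.2 (by linarith))
    have hl2 : 0 < Real.log 2 := Real.log_pos (by norm_num)
    refine Summable.of_norm_bounded_eventually_nat h1 ?_
    filter_upwards [Filter.eventually_ge_atTop 1] with k hk
    have hk' : (0 : ℝ) < k := by exact_mod_cast hk
    have hlog : k * Real.log 2 ≤ Real.log ((2 ^ k : ℕ) + 2) := by
      rw [← Real.log_pow]
      exact Real.log_le_log (by positivity) (by push_cast; linarith)
    have hp := log_natCast_add_two_pos (2 ^ k)
    rw [Real.norm_of_nonneg (by positivity), ← Real.mul_rpow hk'.le hl2.le, ← mul_assoc]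
    calc _ ≤ 1 * Real.log ((2 ^ k : ℕ) + 2) ^ (-α) := by
          gcongr
          push_cast
          rw [← div_eq_mul_inv, div_le_one (by positivity)]
          linarith
      _ ≤ _ := by
          rw [one_mul]
          exact Real.rpow_le_rpow_of_nonpos (by positivity) hlog (by linarith)

lemma not_summable_rpow_mul_log (hα : 0 ≤ α) (h : γ < 1 ∨ γ = 1 ∧ α ≤ 1) :
    ¬ Summable fun k : ℕ => ((k : ℝ) + 2) ^ (-γ) * Real.log (k + 2) ^ (-α) := by
  intro hs
  have harm : ¬ Summable fun k : ℕ => ((k : ℝ) + 2)⁻¹ := by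
    intro h'
    refine Real.not_summable_natCast_inv ((summable_nat_add_iff 2).1 ?_)
    simpa using h'
  rcases h with h | ⟨rfl, h⟩
  -- With this `ε`, the bound `log t ≤ t ^ ε / ε` leaves the exponent `-γ - ε * α = ε - 1 ≥ -1`.
  · set ε := (1 - γ) / (α + 1) with hε
    have hε0 : 0 < ε := div_pos (by linarith) (by linarith)
    refine harm (Summable.of_nonneg_of_le (fun k => by positivity) (fun k => ?_)
      (hs.mul_left (ε ^ (-α))))
    have hx : (1 : ℝ) ≤ (k : ℝ) + 2 := by have : (0 : ℝ) ≤ k := by positivity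
                                          linarith
    have hx0 : (0 : ℝ) < (k : ℝ) + 2 := by linarith
    have hl := log_natCast_add_two_pos k
    have h1 := Real.log_le_rpow_div hx0.le hε0
    have h2 : (((k : ℝ) + 2) ^ ε / ε) ^ (-α) ≤ Real.log (k + 2) ^ (-α) :=
      Real.rpow_le_rpow_of_nonpos hl h1 (by linarith)
    rw [Real.div_rpow (by positivity) hε0.le, ← Real.rpow_mul hx0.le] at h2
    have hεα : 0 < ε ^ (-α) := by positivity
    calc ((k : ℝ) + 2)⁻¹ = ((k : ℝ) + 2) ^ (-1 : ℝ) := (Real.rpow_neg_one _).symm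
      _ ≤ ((k : ℝ) + 2) ^ (-γ + ε * -α) := by
          refine Real.rpow_le_rpow_of_exponent_le hx ?_
          have : ε * (α + 1) = 1 - γ := div_mul_cancel₀ _ (by linarith)
          nlinarith
      _ = ε ^ (-α) * (((k : ℝ) + 2) ^ (-γ) * (((k : ℝ) + 2) ^ (ε * -α) / ε ^ (-α))) := by
          rw [Real.rpow_add hx0]; field_simp
      _ ≤ _ := by gcongr
  · simp_rw [Real.rpow_neg_one] at hs
    rw [summable_condensed_log hα] at hs
    have hl2 : 0 < Real.log 2 := Real.log_pos (by norm_num)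
    refine harm (Summable.of_nonneg_of_le (fun k => by positivity) (fun k => ?_)
      (hs.mul_left 3))
    have hx : (1 : ℝ) ≤ (k : ℝ) + 2 := by have : (0 : ℝ) ≤ k := by positivity
                                          linarith
    have h2k : (1 : ℝ) ≤ 2 ^ k := one_le_pow₀ (by norm_num)
    have hp := log_natCast_add_two_pos (2 ^ k)
    have hlog : Real.log ((2 ^ k : ℕ) + 2) ≤ (k : ℝ) + 2 := by
      calc Real.log ((2 ^ k : ℕ) + 2) ≤ Real.log (2 ^ (k + 2)) := by
            refine Real.log_le_log (by positivity) ?_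
            push_cast
            rw [pow_add]; linarith
        _ = (k + 2 : ℕ) * Real.log 2 := Real.log_pow _ _
        _ ≤ ((k : ℝ) + 2) * 1 := by
            push_cast; gcongr; have := Real.log_two_lt_d9; linarith
        _ = _ := mul_one _
    have h3 : ((k : ℝ) + 2)⁻¹ ≤ Real.log ((2 ^ k : ℕ) + 2) ^ (-α) := by
      calc ((k : ℝ) + 2)⁻¹ = ((k : ℝ) + 2) ^ (-1 : ℝ) := (Real.rpow_neg_one _).symm
        _ ≤ ((k : ℝ) + 2) ^ (-α) := Real.rpow_le_rpow_of_exponent_le hx (by linarith)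
        _ ≤ _ := Real.rpow_le_rpow_of_nonpos hp hlog (by linarith)
    have h4 : 1 ≤ 3 * ((2 : ℝ) ^ k * ((2 ^ k : ℕ) + 2 : ℝ)⁻¹) := by
      push_cast
      rw [← div_eq_mul_inv, ← mul_div_assoc, one_le_div (by positivity)]
      linarith
    calc ((k : ℝ) + 2)⁻¹ ≤ 1 * Real.log ((2 ^ k : ℕ) + 2) ^ (-α) := by rw [one_mul]; exact h3
      _ ≤ (3 * ((2 : ℝ) ^ k * ((2 ^ k : ℕ) + 2 : ℝ)⁻¹)) * Real.log ((2 ^ k : ℕ) + 2) ^ (-α) := by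
          gcongr
      _ = _ := by ring

end Series

/-! ### Finite expectation above the threshold -/

section Finiteness

variable {ρ α : ℝ} {w : ℕ → ℝ}

lemma sum_inv_sq_le {B : ℝ} (hB : 0 < B) (a : ℕ) :
    ∑ b ∈ (Finset.range a).filter fun b : ℕ => ¬ ((b : ℝ) + 3 ≤ B), (((b : ℝ) + 3) ^ 2)⁻¹ ≤
      2 / B := by
  have h1 : ∑ b ∈ (Finset.range a).filter fun b : ℕ => ¬ ((b : ℝ) + 3 ≤ B), (((b : ℝ) + 3) ^ 2)⁻¹ =
      ∑ i ∈ ((Finset.range a).filter fun b : ℕ => ¬ ((b : ℝ) + 3 ≤ B)).image (fun b : ℕ => b + 3),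
        ((i : ℝ) ^ 2)⁻¹ := by
    rw [Finset.sum_image (fun _ _ _ _ h => Nat.add_right_cancel h)]
    exact Finset.sum_congr rfl fun b _ => by push_cast; rfl
  rw [h1]
  refine (Finset.sum_le_sum_of_subset_of_nonneg (t := Finset.Ioo ⌊B⌋₊ (a + 3)) ?_
    fun _ _ _ => by positivity).trans ((sum_Ioo_inv_sq_le _ _).trans ?_)
  · intro i hi
    simp only [Finset.mem_image, Finset.mem_filter, Finset.mem_range, not_le] at hi
    obtain ⟨b, ⟨hb, hb'⟩, rfl⟩ := hi
    rw [Finset.mem_Ioo]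
    refine ⟨?_, by omega⟩
    rw [Nat.floor_lt hB.le]
    push_cast; exact hb'
  · have := Nat.lt_floor_add_one B
    gcongr

/-- The two terms of the minimum cross near `b = B = A ^ θ`, where `b ^ ρ = A ^ (ρ - 1)`. The at
most `B` smaller values of `b` contribute `B * A / v(a)`, with `v` the reference weight, and the
larger ones about `B / v(B)`; both have order `A ^ (-γ) * log A ^ (-α)`. -/
lemma sum_min_refWeight_le (hρ : 2 < ρ) (hα : 0 ≤ α) :
    ∃ c : ℝ, 0 ≤ c ∧ ∀ a : ℕ, ∑ b ∈ Finset.range a,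
      min (a / refWeight ρ α a) (refWeight ρ α (b + 1))⁻¹ ≤
        c * (((a : ℝ) + 2) ^ (-((ρ - 1) ^ 2 / ρ)) * Real.log (a + 2) ^ (-α)) := by
  have hρ0 : 0 < ρ := by linarith
  set θ := 1 - 1 / ρ with hθ
  have hθ0 : 0 < θ := by
    rw [hθ, sub_pos, div_lt_one hρ0]; linarith
  refine ⟨1 + θ ^ (-α) * 2, by positivity, fun a => ?_⟩
  set A : ℝ := (a : ℝ) + 2 with hA
  have hA1 : 1 ≤ A := by have : (0 : ℝ) ≤ a := by positivity
                         linarith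
  have hA0 : 0 < A := by linarith
  have hlA : 0 < Real.log A := log_natCast_add_two_pos a
  set B : ℝ := A ^ θ with hB
  have hB0 : 0 < B := by positivity
  set γ := (ρ - 1) ^ 2 / ρ with hγ
  have hlog : Real.log B = θ * Real.log A := Real.log_rpow hA0 _
  rw [← Finset.sum_filter_add_sum_filter_not _ (fun b : ℕ => (b : ℝ) + 3 ≤ B), add_mul, one_mul]
  refine add_le_add ?_ ?_
  · have hcard : (((Finset.range a).filter fun b : ℕ => (b : ℝ) + 3 ≤ B).card : ℝ) ≤ B := by
      have : (Finset.range a).filter (fun b : ℕ => (b : ℝ) + 3 ≤ B) ⊆ Finset.range ⌊B⌋₊ := by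
        intro b hb
        simp only [Finset.mem_filter, Finset.mem_range] at hb ⊢
        rw [← Nat.succ_le_iff, Nat.le_floor_iff hB0.le]
        push_cast; linarith [hb.2]
      calc _ ≤ ((Finset.range ⌊B⌋₊).card : ℝ) := by exact_mod_cast Finset.card_le_card this
        _ ≤ B := by simpa using Nat.floor_le hB0.le
    calc _ ≤ ∑ b ∈ (Finset.range a).filter (fun b : ℕ => (b : ℝ) + 3 ≤ B),
          A / refWeight ρ α a := by
          refine Finset.sum_le_sum fun b _ => (min_le_left _ _).trans ?_
          have := refWeight_pos (ρ := ρ) (α := α) a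
          gcongr; linarith
      _ ≤ B * (A / refWeight ρ α a) := by
          rw [Finset.sum_const, nsmul_eq_mul]
          have := refWeight_pos (ρ := ρ) (α := α) a
          gcongr
      _ = A ^ (-γ) * Real.log A ^ (-α) := by
          rw [refWeight, ← hA, hB, Real.rpow_neg hlA.le]
          have : -γ = θ + (1 - ρ) := by rw [hγ, hθ]; field_simp; ring
          rw [this, Real.rpow_add hA0, Real.rpow_sub hA0 1 ρ, Real.rpow_one]
          field_simp
  · calc _ ≤ ∑ b ∈ (Finset.range a).filter (fun b : ℕ => ¬ ((b : ℝ) + 3 ≤ B)),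
          (((b : ℝ) + 3) ^ 2)⁻¹ * (B ^ (-(ρ - 2)) * (θ * Real.log A) ^ (-α)) := by
          refine Finset.sum_le_sum fun b hb => (min_le_right _ _).trans ?_
          simp only [Finset.mem_filter, not_le] at hb
          have hx : (0 : ℝ) < (b : ℝ) + 3 := by positivity
          have h1 : refWeight ρ α (b + 1) = ((b : ℝ) + 3) ^ ρ * Real.log (b + 3) ^ α := by
            rw [refWeight]; push_cast; ring_nf
          have hlx : 0 < Real.log ((b : ℝ) + 3) := Real.log_pos (by linarith [hx])
          -- An inverse square is split off for summation; the remaining power is decreasing since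
          -- `ρ > 2`.
          have h2 : (((b : ℝ) + 3) ^ ρ)⁻¹ = (((b : ℝ) + 3) ^ 2)⁻¹ * ((b : ℝ) + 3) ^ (-(ρ - 2)) := by
            rw [← Real.rpow_neg hx.le, ← Real.rpow_natCast, ← Real.rpow_neg hx.le,
              ← Real.rpow_add hx]
            congr 1; push_cast; ring
          rw [h1, mul_inv, h2, mul_assoc, ← Real.rpow_neg hlx.le]
          refine mul_le_mul_of_nonneg_left ?_ (by positivity)
          refine mul_le_mul ?_ ?_ (by positivity) (by positivity)
          · exact Real.rpow_le_rpow_of_nonpos hB0 hb.2.le (by linarith)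
          · rw [← hlog]
            refine Real.rpow_le_rpow_of_nonpos (by rw [hlog]; positivity)
              (Real.log_le_log hB0 hb.2.le) (by linarith)
      _ ≤ 2 / B * (B ^ (-(ρ - 2)) * (θ * Real.log A) ^ (-α)) := by
          rw [← Finset.sum_mul]
          exact mul_le_mul_of_nonneg_right (sum_inv_sq_le hB0 a) (by positivity)
      _ = _ := by
          rw [Real.mul_rpow hθ0.le hlA.le]
          have h3 : B⁻¹ * B ^ (-(ρ - 2)) = A ^ (-γ) := by
            rw [← Real.rpow_neg_one B, ← Real.rpow_add hB0, hB, ← Real.rpow_mul hA0.le]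
            congr 1; rw [hγ, hθ]; field_simp; ring
          rw [← h3]; field_simp

lemma tsum_one_add_div_refWeight_ne_top (hρ : 2 < ρ) (hα : 0 ≤ α) :
    ∑' k : ℕ, ENNReal.ofReal ((1 + k) * (refWeight ρ α k)⁻¹) ≠ ⊤ := by
  have h1 : Summable fun k : ℕ => ((k : ℝ) + 2) ^ (1 - ρ) * Real.log 2 ^ (-α) := by
    refine Summable.mul_right _ ?_
    have := (summable_nat_add_iff 2).2 (Real.summable_nat_rpow.2 (show 1 - ρ < -1 by linarith))
    simpa using this
  refine ne_top_of_le_ne_top h1.tsum_ofReal_ne_top (ENNReal.tsum_le_tsum fun k =>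
    ENNReal.ofReal_le_ofReal ?_)
  have hl := log_natCast_add_two_pos k
  have hl2 := log_two_le_log_natCast_add_two k
  have hx : (0 : ℝ) < (k : ℝ) + 2 := by positivity
  rw [refWeight, mul_inv, ← mul_assoc, Real.rpow_sub hx, Real.rpow_one, div_eq_mul_inv,
    ← Real.rpow_neg hl.le]
  refine mul_le_mul ?_ (Real.rpow_le_rpow_of_nonpos (Real.log_pos (by norm_num)) hl2
    (by linarith)) (by positivity) (by positivity)
  exact mul_le_mul_of_nonneg_right (by linarith) (by positivity)

/-- On `a ≤ b` the bound is independent of `a`, and counting the values of `a` yields the factor `b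
+ 1`. -/
lemma tsum_tsum_max_ne_top {F : ℕ → ℕ → ℝ≥0∞} {f : ℕ → ℝ≥0∞} {g : ℕ → ℕ → ℝ≥0∞}
    (hf : ∑' b : ℕ, (b + 1 : ℕ) * f b ≠ ⊤) (hg : ∑' a, ∑ b ∈ Finset.range a, g a b ≠ ⊤)
    (hFf : ∀ a b, a ≤ b → F a b ≤ f b) (hFg : ∀ a b, b < a → F a b ≤ g a b) :
    ∑' a, ∑' b, F a b ≠ ⊤ := by
  have h1 : ∑' a, ∑' b, (if a ≤ b then f b else 0) = ∑' b : ℕ, (b + 1 : ℕ) * f b := by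
    rw [ENNReal.tsum_comm]
    refine tsum_congr fun b => ?_
    rw [tsum_eq_sum (s := Finset.range (b + 1)) fun a ha => if_neg (by simpa using ha)]
    rw [Finset.sum_congr rfl fun a ha => if_pos (by simp at ha; omega)]
    simp
  have h2 : ∑' a, ∑' b, (if b < a then g a b else 0) = ∑' a, ∑ b ∈ Finset.range a, g a b := by
    refine tsum_congr fun a => ?_
    rw [tsum_eq_sum (s := Finset.range a) fun b hb => if_neg (by simpa using hb)]
    exact Finset.sum_congr rfl fun b hb => if_pos (by simpa using hb)
  refine ne_top_of_le_ne_top (ENNReal.add_ne_top.2 ⟨hf, hg⟩) ?_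
  rw [← h1, ← h2, ← ENNReal.tsum_add]
  refine ENNReal.tsum_le_tsum fun a => ?_
  rw [← ENNReal.tsum_add]
  refine ENNReal.tsum_le_tsum fun b => ?_
  by_cases h : a ≤ b
  · simpa [h, not_lt.2 h] using hFf a b h
  · simpa [h, not_le.1 h] using hFg a b (not_le.1 h)

/-- The first factor cancels `w a` and leaves `1 / (w a + w (b + 1))`. Over the next `M = max a (b +
1)` departures the count of the crossed edge stays below a multiple of `M`, so each factor is at
most `1 / (1 + y)` with `y` of order `w (b + 1) / w M`. -/
lemma stickWeight_le (hρ : 0 ≤ ρ) (hα : 0 ≤ α) (hw : ∀ k, 0 < w k) {C : ℝ} (hC1 : 1 ≤ C)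
    (hC : ∀ k, w k ≤ C * refWeight ρ α k ∧ refWeight ρ α k ≤ C * w k) (a b : ℕ) :
    stickWeight w 0 a b ≤ C * (refWeight ρ α (max a (b + 1)))⁻¹ ∧
    stickWeight w (max a (b + 1)) a b ≤
      C * min (refWeight ρ α (max a (b + 1)))⁻¹ (C ^ 2 * (3 ^ ρ * 6 ^ α) *
        ((max a (b + 1) : ℕ) * refWeight ρ α (b + 1))⁻¹) := by
  set M := max a (b + 1) with hM
  set v := refWeight ρ α with hv
  have hvpos : ∀ k, 0 < v k := fun k => refWeight_pos k
  have hMpos : (0 : ℝ) < M := by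
    have : 0 < M := by omega
    exact_mod_cast this
  set D : ℝ := 3 ^ ρ * 6 ^ α with hD
  have hD0 : 0 < D := by positivity
  have hmono : Monotone v := refWeight_mono hρ hα
  have hzero : stickWeight w 0 a b ≤ C * (v M)⁻¹ := by
    have h1 : v M ≤ C * (w a + w (b + 1)) := by
      rcases le_total a (b + 1) with h | h
      · rw [hM, max_eq_right h]
        have := (hC (b + 1)).2
        have := hw a
        nlinarith
      · rw [hM, max_eq_left h]
        have := (hC a).2
        have := hw (b + 1)
        nlinarith
    have h2 : stickWeight w 0 a b = (w a + w (b + 1))⁻¹ := by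
      have := hw a
      have := hw (b + 1)
      simp [stickWeight]; field_simp
    have h3 : 0 < w a + w (b + 1) := add_pos (hw _) (hw _)
    rw [h2, ← div_eq_mul_inv, inv_le_comm₀ h3 (div_pos (by linarith) (hvpos M)), inv_div,
      div_le_iff₀' (by linarith)]
    exact h1
  refine ⟨hzero, ?_⟩
  set y : ℝ := v (b + 1) / (C ^ 2 * D * v M) with hy
  have hCpos : 0 < C := by linarith
  have hy0 : 0 < y := div_pos (hvpos _) (mul_pos (by positivity) (hvpos M))
  have hfac : ∀ j < M, w (a + 2 * (j + 1)) / (w (a + 2 * (j + 1)) + w (b + 1)) ≤ (1 + y)⁻¹ := by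
    intro j hj
    have h1 : w (a + 2 * (j + 1)) ≤ C * (D * v M) := by
      refine (hC _).1.trans (mul_le_mul_of_nonneg_left ?_ hCpos.le)
      -- The doubling property with `c = 3`, which is the source of `3 ^ ρ * 6 ^ α`.
      have := refWeight_mul_le hρ hα (c := 3) (by norm_num) (a + 2 * (j + 1)) M (by omega)
      norm_num at this
      exact this
    have h2 : w (a + 2 * (j + 1)) * y ≤ w (b + 1) := by
      calc _ ≤ C * (D * v M) * y := mul_le_mul_of_nonneg_right h1 hy0.le
        _ = v (b + 1) / C := by
            have := hvpos M
            rw [hy]; field_simp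
        _ ≤ w (b + 1) := by
            rw [div_le_iff₀' hCpos]; exact (hC _).2
    rw [div_le_iff₀ (add_pos (hw _) (hw _)), inv_mul_eq_div, le_div_iff₀ (by positivity)]
    linarith
  have hprod : stickWeight w M a b ≤ stickWeight w 0 a b * (1 + M * y)⁻¹ := by
    have h1 : stickWeight w M a b = stickWeight w 0 a b *
        ∏ j ∈ Finset.range M, w (a + 2 * (j + 1)) / (w (a + 2 * (j + 1)) + w (b + 1)) := by
      simp only [stickWeight, Finset.prod_range_succ']
      simp; ring
    rw [h1]
    refine mul_le_mul_of_nonneg_left ?_ (stickWeight_nonneg hw 0 a b)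
    calc _ ≤ ∏ j ∈ Finset.range M, (1 + y)⁻¹ :=
          Finset.prod_le_prod (fun j _ => div_nonneg (hw _).le (add_pos (hw _) (hw _)).le)
            fun j hj => hfac j (by simpa using hj)
      _ = ((1 + y) ^ M)⁻¹ := by simp
      _ ≤ (1 + M * y)⁻¹ := by
          -- Bernoulli's inequality; a decay of order `1 / (M * y)` is all that is needed.
          have := one_add_mul_le_pow (show (-2 : ℝ) ≤ y by linarith) M
          gcongr
  have hle : stickWeight w M a b ≤ C * (v M)⁻¹ * (1 + M * y)⁻¹ :=
    hprod.trans (mul_le_mul_of_nonneg_right hzero (by positivity))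
  have hvM := hvpos M
  have hvb := hvpos (b + 1)
  rw [mul_min_of_nonneg _ _ hCpos.le, le_min_iff]
  constructor
  · refine hle.trans (mul_le_of_le_one_right (by positivity) (inv_le_one_of_one_le₀ ?_))
    have : 0 ≤ M * y := by positivity
    linarith
  · calc _ ≤ C * (v M)⁻¹ * (1 + M * y)⁻¹ := hle
      _ ≤ C * (v M)⁻¹ * (M * y)⁻¹ := by gcongr; linarith
      _ = _ := by rw [hy]; field_simp

section Summability

variable {C : ℝ}

lemma tsum_one_add_div_ne_top (hρ : 2 < ρ) (hα : 0 ≤ α) (hw : ∀ k, 0 < w k) (hC1 : 1 ≤ C)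
    (hC : ∀ k, w k ≤ C * refWeight ρ α k ∧ refWeight ρ α k ≤ C * w k) :
    ∑' k : ℕ, ENNReal.ofReal ((1 + k) * (w k)⁻¹) ≠ ⊤ := by
  refine ne_top_of_le_ne_top (ENNReal.mul_ne_top (ENNReal.ofReal_ne_top (r := C))
    (tsum_one_add_div_refWeight_ne_top hρ hα)) ?_
  rw [← ENNReal.tsum_mul_left]
  refine ENNReal.tsum_le_tsum fun k => ?_
  rw [← ENNReal.ofReal_mul (by linarith)]
  refine ENNReal.ofReal_le_ofReal ?_
  have hv := refWeight_pos (ρ := ρ) (α := α) k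
  have hwk := hw k
  have : (w k)⁻¹ ≤ C * (refWeight ρ α k)⁻¹ := by
    rw [← div_eq_mul_inv, inv_le_comm₀ hwk (by positivity), inv_div, div_le_iff₀' (by linarith)]
    exact (hC k).2
  calc (1 + k : ℝ) * (w k)⁻¹ ≤ (1 + k) * (C * (refWeight ρ α k)⁻¹) := by gcongr
    _ = _ := by ring

lemma tsum_succ_mul_refWeight_ne_top (hρ : 2 < ρ) (hα : 0 ≤ α) {c : ℝ} (hc : 0 ≤ c) :
    ∑' b : ℕ, (b + 1 : ℕ) * ENNReal.ofReal (c * (refWeight ρ α (b + 1))⁻¹) ≠ ⊤ := by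
  refine ne_top_of_le_ne_top (ENNReal.mul_ne_top (ENNReal.ofReal_ne_top (r := c))
    (tsum_one_add_div_refWeight_ne_top hρ hα)) ?_
  rw [← ENNReal.tsum_mul_left]
  refine ENNReal.tsum_le_tsum fun k => ?_
  rw [← ENNReal.ofReal_mul hc, ← ENNReal.ofReal_natCast, ← ENNReal.ofReal_mul (by positivity)]
  refine ENNReal.ofReal_le_ofReal ?_
  have hv := refWeight_pos (ρ := ρ) (α := α) k
  have hle := refWeight_mono (ρ := ρ) (α := α) (by linarith) hα (Nat.le_succ k)
  calc ((k + 1 : ℕ) : ℝ) * (c * (refWeight ρ α (k + 1))⁻¹)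
      ≤ (k + 1 : ℕ) * (c * (refWeight ρ α k)⁻¹) := by gcongr
    _ = _ := by push_cast; ring

lemma tsum_stickWeight_zero_ne_top (hρ : 2 < ρ) (hα : 0 ≤ α) (hw : ∀ k, 0 < w k) (hC1 : 1 ≤ C)
    (hC : ∀ k, w k ≤ C * refWeight ρ α k ∧ refWeight ρ α k ≤ C * w k) :
    ∑' a, ∑' b, ENNReal.ofReal (stickWeight w 0 a b) ≠ ⊤ := by
  have hC0 : 0 ≤ C := by linarith
  refine tsum_tsum_max_ne_top (f := fun b => ENNReal.ofReal (C * (refWeight ρ α (b + 1))⁻¹))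
    (g := fun a _ => ENNReal.ofReal (C * (refWeight ρ α a)⁻¹))
    (tsum_succ_mul_refWeight_ne_top hρ hα hC0) ?_ ?_ ?_
  · refine ne_top_of_le_ne_top (ENNReal.mul_ne_top (ENNReal.ofReal_ne_top (r := C))
      (tsum_one_add_div_refWeight_ne_top hρ hα)) ?_
    rw [← ENNReal.tsum_mul_left]
    refine ENNReal.tsum_le_tsum fun a => ?_
    rw [Finset.sum_const, Finset.card_range, nsmul_eq_mul, ← ENNReal.ofReal_natCast,
      ← ENNReal.ofReal_mul (by positivity), ← ENNReal.ofReal_mul hC0]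
    refine ENNReal.ofReal_le_ofReal ?_
    have hv := refWeight_pos (ρ := ρ) (α := α) a
    rw [mul_left_comm]
    gcongr
    linarith
  · intro a b hab
    have := (stickWeight_le (by linarith) hα hw hC1 hC a b).1
    rw [max_eq_right (by omega)] at this
    exact ENNReal.ofReal_le_ofReal this
  · intro a b hab
    have := (stickWeight_le (by linarith) hα hw hC1 hC a b).1
    rw [max_eq_left (by omega)] at this
    exact ENNReal.ofReal_le_ofReal this

/-- In both regions `1 + a + b` is at most `2 * max a (b + 1)`. The region `a ≤ b` needs only `ρ >
2`; the region `b < a` is where `γ` enters. -/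
lemma tsum_mul_stickWeight_ne_top (hρ : 2 < ρ) (hα : 0 ≤ α)
    (hγ : 1 < (ρ - 1) ^ 2 / ρ ∨ (ρ - 1) ^ 2 / ρ = 1 ∧ 1 < α) (hw : ∀ k, 0 < w k) (hC1 : 1 ≤ C)
    (hC : ∀ k, w k ≤ C * refWeight ρ α k ∧ refWeight ρ α k ≤ C * w k) :
    ∑' a : ℕ, ∑' b : ℕ, ENNReal.ofReal ((1 + a + b : ℕ) * stickWeight w (max a (b + 1)) a b)
      ≠ ⊤ := by
  set E : ℝ := C ^ 2 * (3 ^ ρ * 6 ^ α) with hE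
  have hC0 : 0 ≤ C := by linarith
  have hE1 : 1 ≤ E := by
    have h1 : (1 : ℝ) ≤ 3 ^ ρ := Real.one_le_rpow (by norm_num) (by linarith)
    have h2 : (1 : ℝ) ≤ 6 ^ α := Real.one_le_rpow (by norm_num) hα
    have h3 : 1 ≤ C ^ 2 := one_le_pow₀ hC1
    exact one_le_mul_of_one_le_of_one_le h3 (one_le_mul_of_one_le_of_one_le h1 h2)
  have hE0 : 0 ≤ E := by linarith
  obtain ⟨c, hc0, hc⟩ := sum_min_refWeight_le hρ hα
  have hv : ∀ k, 0 < refWeight ρ α k := fun k => refWeight_pos k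
  refine tsum_tsum_max_ne_top
    (f := fun b => ENNReal.ofReal ((2 * C * E) * (refWeight ρ α (b + 1))⁻¹))
    (g := fun a b => ENNReal.ofReal ((2 * C * E) *
      min (a / refWeight ρ α a) (refWeight ρ α (b + 1))⁻¹))
    (tsum_succ_mul_refWeight_ne_top hρ hα (by positivity)) ?_ ?_ ?_
  · have hs := ((summable_rpow_mul_log hα hγ).mul_left (2 * C * E * c)).tsum_ofReal_ne_top
    refine ne_top_of_le_ne_top hs (ENNReal.tsum_le_tsum fun a => ?_)
    rw [← ENNReal.ofReal_sum_of_nonneg]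
    · refine ENNReal.ofReal_le_ofReal ?_
      rw [← Finset.mul_sum, mul_assoc (2 * C * E)]
      exact mul_le_mul_of_nonneg_left (hc a) (by positivity)
    · intro b _
      have h1 := hv a
      have h2 := hv (b + 1)
      positivity
  · intro a b hab
    have h1 := (stickWeight_le (by linarith) hα hw hC1 hC a b).2
    have h2 := hv (b + 1)
    rw [max_eq_right (show a ≤ b + 1 by omega)] at h1 ⊢
    refine ENNReal.ofReal_le_ofReal ?_
    have h3 : ((1 + a + b : ℕ) : ℝ) ≤ 2 * (b + 1 : ℕ) := by
      have : 1 + a + b ≤ 2 * (b + 1) := by omega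
      exact_mod_cast this
    calc _ ≤ (2 * (b + 1 : ℕ)) * (C * (E * ((b + 1 : ℕ) * refWeight ρ α (b + 1))⁻¹)) := by
          refine mul_le_mul h3 (h1.trans ?_) (stickWeight_nonneg hw _ _ _) (by positivity)
          gcongr
          exact min_le_right _ _
      _ = _ := by push_cast; field_simp
  · intro a b hab
    have h1 := (stickWeight_le (by linarith) hα hw hC1 hC a b).2
    have h2 := hv (b + 1)
    have h2' := hv a
    rw [max_eq_left (show b + 1 ≤ a by omega)] at h1 ⊢
    refine ENNReal.ofReal_le_ofReal ?_
    have ha : (0 : ℝ) < a := by exact_mod_cast (show 0 < a by omega)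
    have h3 : ((1 + a + b : ℕ) : ℝ) ≤ 2 * a := by
      have : 1 + a + b ≤ 2 * a := by omega
      exact_mod_cast this
    calc _ ≤ (2 * (a : ℝ)) * (C * (E * min (refWeight ρ α a)⁻¹ ((a * refWeight ρ α (b + 1))⁻¹))) := by
          refine mul_le_mul h3 (h1.trans ?_) (stickWeight_nonneg hw _ _ _) (by positivity)
          gcongr
          rw [mul_min_of_nonneg _ _ hE0]
          refine min_le_min ?_ le_rfl
          exact le_mul_of_one_le_left (by positivity) hE1
      _ = 2 * C * E * (a * min (refWeight ρ α a)⁻¹ ((a * refWeight ρ α (b + 1))⁻¹)) := by ring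
      _ = _ := by
          rw [mul_min_of_nonneg _ _ ha.le]
          congr 2
          field_simp

end Summability

section Walk

variable {V : Type*} [Fintype V] [DecidableEq V] [MeasurableSpace V] [DiscreteMeasurableSpace V]
variable {Ω : Type*} [MeasurableSpace Ω]
variable {G : SimpleGraph V} [DecidableRel G.Adj] {ℓ₀ : Sym2 V → ℕ} {v₀ : V}
  {P : Measure Ω} [IsProbabilityMeasure P] {I : ℕ → Ω → V}

theorem IsERRW.expectedAttractionTime_lt_top_of_regular (hI : IsERRW G w ℓ₀ v₀ P I)
    (hv : ∃ y, G.Adj v₀ y) (hw : ∀ k, 0 < w k) (hρ : 2 < ρ) (hα : 0 ≤ α)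
    (hwk : ∀ k : ℕ, 2 ≤ k → w k = (k : ℝ) ^ ρ * Real.log k ^ α)
    (hγ : 1 < (ρ - 1) ^ 2 / ρ ∨ (ρ - 1) ^ 2 / ρ = 1 ∧ 1 < α) :
    expectedAttractionTime G ℓ₀ P I < ⊤ := by
  obtain ⟨C, hC1, hC⟩ := exists_comparable_refWeight (by linarith) hα hw hwk
  exact hI.expectedAttractionTime_lt_top hw hv (tsum_one_add_div_ne_top hρ hα hw hC1 hC)
    (tsum_stickWeight_zero_ne_top hρ hα hw hC1 hC)
    (tsum_mul_stickWeight_ne_top hρ hα hγ hw hC1 hC)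

end Walk

end Finiteness

/-! ### A two-colour urn with losses -/

section Recursion

lemma exp_neg_le_prod_inv {s : Finset ℕ} {f : ℕ → ℝ} (hf : ∀ i, 0 ≤ f i) {S : ℝ}
    (hS : ∑ i ∈ s, f i ≤ S) : Real.exp (-S) ≤ ∏ i ∈ s, (1 + f i)⁻¹ := by
  rw [Real.exp_neg, Finset.prod_inv_distrib]
  refine inv_anti₀ (Finset.prod_pos fun i _ => by linarith [hf i]) ?_
  exact (Real.prod_one_add_le_exp_sum s hf).trans (Real.exp_le_exp.2 hS)

/-- A lower bound for the solutions of the recursion satisfied by the visiting probabilities of a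
generalized urn with two colours. -/
lemma exists_le_of_urn_recursion {p : ℕ → ℕ → ℝ} {A B κ κ' : ℕ → ℝ}
    (hA : ∀ i, 0 < A i) (hB : ∀ j, 0 < B j) (hκ : ∀ i, 0 < κ i) (hκ' : ∀ j, 0 < κ' j)
    (h00 : 0 < p 0 0)
    (h1 : ∀ i j, p i j * (κ i * (A i / (A i + B j))) ≤ p (i + 1) j)
    (h2 : ∀ i j, p i j * (κ' j * (B j / (A i + B j))) ≤ p i (j + 1))
    (h3 : ∀ i j, p i (j + 1) * (κ i * (A i / (A i + B (j + 1)))) +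
      p (i + 1) j * (κ' j * (B j / (A (i + 1) + B j))) ≤ p (i + 1) (j + 1))
    {k S : ℝ} (hk : 0 < k) (hprod : ∀ n, k ≤ ∏ i ∈ Finset.range n, κ i)
    (hprod' : ∀ n, k ≤ ∏ j ∈ Finset.range n, κ' j)
    (hAS : ∀ n, ∑ i ∈ Finset.range n, (A i)⁻¹ ≤ S) (hBS : ∀ n, ∑ j ∈ Finset.range n, (B j)⁻¹ ≤ S) :
    ∃ c : ℝ, 0 < c ∧ ∀ i j, c * ((A i)⁻¹ + (B j)⁻¹) ≤ p i j := by
  set K : ℕ → ℝ := fun i => ∏ i' ∈ Finset.range i, κ i' with hK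
  set K' : ℕ → ℝ := fun j => ∏ j' ∈ Finset.range j, κ' j' with hK'
  have hK0 : ∀ i, 0 < K i := fun i => Finset.prod_pos fun _ _ => hκ _
  have hK'0 : ∀ i, 0 < K' i := fun i => Finset.prod_pos fun _ _ => hκ' _
  have hAinv : ∀ i, (A i)⁻¹ ≤ S := fun i =>
    (Finset.single_le_sum (f := fun i => (A i)⁻¹) (fun i _ => (inv_pos.2 (hA i)).le)
      (Finset.self_mem_range_succ i)).trans (hAS (i + 1))
  have hBinv : ∀ i, (B i)⁻¹ ≤ S := fun i =>
    (Finset.single_le_sum (f := fun i => (B i)⁻¹) (fun i _ => (inv_pos.2 (hB i)).le)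
      (Finset.self_mem_range_succ i)).trans (hBS (i + 1))
  have hS0 : 0 < S := (inv_pos.2 (hA 0)).trans_le (hAinv 0)
  have hrow : ∀ i, p 0 0 * K i * ∏ i' ∈ Finset.range i, (1 + B 0 / A i')⁻¹ ≤ p i 0 := by
    intro i
    -- Along the axes there is a single predecessor, so the solution is a product; it stays bounded
    -- below because `∑ 1 / A` converges.
    induction i with
    | zero => simp [hK]
    | succ i ih =>
      refine le_trans (le_of_eq ?_) ((mul_le_mul_of_nonneg_right ih ?_).trans (h1 i 0))
      · have e1 : (1 + B 0 / A i)⁻¹ = A i / (A i + B 0) := by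
          have := hA i
          have := hB 0
          field_simp
        simp only [hK, Finset.prod_range_succ]
        rw [e1]; ring
      · have := hA i
        have := hB 0
        have := hκ i
        positivity
  have hcol : ∀ j, p 0 0 * K' j * ∏ j' ∈ Finset.range j, (1 + A 0 / B j')⁻¹ ≤ p 0 j := by
    intro j
    induction j with
    | zero => simp [hK']
    | succ j ih =>
      refine le_trans (le_of_eq ?_) ((mul_le_mul_of_nonneg_right ih ?_).trans (h2 0 j))
      · have e1 : (1 + A 0 / B j)⁻¹ = B j / (A 0 + B j) := by
          have := hB j
          have := hA 0
          field_simp; ring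
        simp only [hK', Finset.prod_range_succ]
        rw [e1]; ring
      · have := hB j
        have := hA 0
        have := hκ' j
        positivity
  set m : ℝ := min (Real.exp (-(B 0 * S))) (Real.exp (-(A 0 * S))) with hm
  have hm0 : 0 < m := lt_min (Real.exp_pos _) (Real.exp_pos _)
  have hrow' : ∀ i, m ≤ ∏ i' ∈ Finset.range i, (1 + B 0 / A i')⁻¹ := fun i =>
    (min_le_left _ _).trans (exp_neg_le_prod_inv (fun i => (div_pos (hB 0) (hA i)).le) (by
      simp_rw [div_eq_mul_inv, ← Finset.mul_sum]
      exact mul_le_mul_of_nonneg_left (hAS i) (hB 0).le))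
  have hcol' : ∀ j, m ≤ ∏ j' ∈ Finset.range j, (1 + A 0 / B j')⁻¹ := fun j =>
    (min_le_right _ _).trans (exp_neg_le_prod_inv (fun i => (div_pos (hA 0) (hB i)).le) (by
      simp_rw [div_eq_mul_inv, ← Finset.mul_sum]
      exact mul_le_mul_of_nonneg_left (hBS j) (hA 0).le))
  -- Chosen so that the comparison holds on both axes, where `(A i)⁻¹ + (B j)⁻¹ ≤ 2 * S`.
  set c₀ : ℝ := p 0 0 * m / (2 * S) with hc₀
  have hc₀0 : 0 < c₀ := by positivity
  have hsmall : ∀ i j, c₀ * ((A i)⁻¹ + (B j)⁻¹) ≤ p 0 0 * m := by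
    intro i j
    calc c₀ * ((A i)⁻¹ + (B j)⁻¹) ≤ c₀ * (2 * S) := by
          have := hAinv i
          have := hBinv j
          gcongr; linarith
      _ = _ := by rw [hc₀]; field_simp
  have key : ∀ i j, K i * K' j * (c₀ * ((A i)⁻¹ + (B j)⁻¹)) ≤ p i j := by
    intro i
    induction i with
    | zero =>
      intro j
      refine le_trans ?_ (hcol j)
      have : K 0 = 1 := by simp [hK]
      rw [this, one_mul]
      calc _ ≤ K' j * (p 0 0 * m) := mul_le_mul_of_nonneg_left (hsmall _ _) (hK'0 j).le
        _ = p 0 0 * K' j * m := by ring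
        _ ≤ _ := mul_le_mul_of_nonneg_left (hcol' j) (mul_pos h00 (hK'0 j)).le
    | succ i ihi =>
      intro j
      induction j with
      | zero =>
        refine le_trans ?_ (hrow (i + 1))
        have : K' 0 = 1 := by simp [hK']
        rw [this, mul_one]
        calc _ ≤ K (i + 1) * (p 0 0 * m) := mul_le_mul_of_nonneg_left (hsmall _ _) (hK0 _).le
          _ = p 0 0 * K (i + 1) * m := by ring
          _ ≤ _ := mul_le_mul_of_nonneg_left (hrow' _) (mul_pos h00 (hK0 _)).le
      | succ j ihj =>
        refine le_trans ?_ (h3 i j)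
        have a1 := hA i
        have a2 := hA (i + 1)
        have b1 := hB j
        have b2 := hB (j + 1)
        have f1 : 0 ≤ κ i * (A i / (A i + B (j + 1))) := by have := hκ i; positivity
        have f2 : 0 ≤ κ' j * (B j / (A (i + 1) + B j)) := by have := hκ' j; positivity
        -- Apart from the losses, the two terms are `(1 / A i + 1 / B (j+1)) * A i / (A i + B (j+1))
        -- = 1 / B (j+1)` and, symmetrically, `1 / A (i+1)`: an exact solution. The losses are
        -- carried by `K` and `K'`.
        refine le_trans (le_of_eq ?_) (add_le_add (mul_le_mul_of_nonneg_right (ihi (j + 1)) f1)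
          (mul_le_mul_of_nonneg_right ihj f2))
        have e1 : K (i + 1) = K i * κ i := Finset.prod_range_succ _ _
        have e2 : K' (j + 1) = K' j * κ' j := Finset.prod_range_succ _ _
        rw [e1, e2]
        field_simp
        ring
  refine ⟨k * k * c₀, by positivity, fun i j => le_trans ?_ (key i j)⟩
  have a1 := hA i
  have b1 := hB j
  rw [mul_assoc]
  refine mul_le_mul_of_nonneg_right ?_ (by positivity)
  exact mul_le_mul (hprod i) (hprod' j) hk.le (hK0 i).le

end Recursion

/-! ### Round trips from a vertex along two of its edges -/

section Walk

variable {V : Type*} [Fintype V] [DecidableEq V] [MeasurableSpace V] [DiscreteMeasurableSpace V]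
variable {Ω : Type*} [MeasurableSpace Ω]
variable {G : SimpleGraph V} [DecidableRel G.Adj] {w : ℕ → ℝ} {ℓ₀ : Sym2 V → ℕ} {v₀ : V}
  {P : Measure Ω} {I : ℕ → Ω → V}

lemma sum_ite_sym2_le {c : ℝ} (hc : 0 ≤ c) (s : Finset V) (u : V) (e : Sym2 V) :
    ∑ v ∈ s, (if s(u, v) = e then c else 0) ≤ if u ∈ e then c else 0 := by
  by_cases h : u ∈ e
  · obtain ⟨v₁, rfl⟩ := h
    simp only [Sym2.congr_right, Finset.sum_ite_eq']
    rw [if_pos (Sym2.mem_mk_left u v₁)]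
    split_ifs <;> simp [hc]
  · rw [if_neg h]
    refine (Finset.sum_eq_zero fun v _ => if_neg ?_).le
    rintro rfl
    exact h (Sym2.mem_mk_left u v)

lemma vertexWeight_le_of_frozen (hw : ∀ k, 0 < w k) {n₀ n : Sym2 V → ℕ} {e f : Sym2 V}
    (h : ∀ g, g ≠ e → g ≠ f → n g = n₀ g) (u : V) :
    vertexWeight G w n u ≤ (∑ u, ∑ v, w (n₀ s(u, v))) + (if u ∈ e then w (n e) else 0) +
      (if u ∈ f then w (n f) else 0) := by
  have h1 : ∀ v, w (n s(u, v)) ≤ w (n₀ s(u, v)) + (if s(u, v) = e then w (n e) else 0) +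
      (if s(u, v) = f then w (n f) else 0) := by
    intro v
    have := hw (n₀ s(u, v))
    have := hw (n e)
    have := hw (n f)
    by_cases he : s(u, v) = e
    · rw [if_pos he, he]
      split_ifs <;> simp <;> rw [← he] <;> linarith
    by_cases hf : s(u, v) = f
    · rw [if_pos hf, if_neg he, hf]; rw [← hf]; linarith
    · rw [if_neg he, if_neg hf, h _ he hf]; linarith
  refine (Finset.sum_le_sum fun v _ => h1 v).trans ?_
  rw [Finset.sum_add_distrib, Finset.sum_add_distrib]
  refine add_le_add (add_le_add ?_ (sum_ite_sym2_le (hw _).le _ _ _))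
    (sum_ite_sym2_le (hw _).le _ _ _)
  refine (Finset.sum_le_sum_of_subset_of_nonneg (Finset.subset_univ _)
    fun _ _ _ => (hw _).le).trans ?_
  exact Finset.single_le_sum (f := fun u => ∑ v, w (n₀ s(u, v)))
    (fun _ _ => Finset.sum_nonneg fun _ _ => (hw _).le) (Finset.mem_univ u)

variable [IsProbabilityMeasure P]

/-- The probability loss of a round trip along an edge with count `a` caused by competing edges of
total weight at most `R`. -/
noncomputable def lossFactor (w : ℕ → ℝ) (R : ℝ) (a : ℕ) : ℝ :=
  (1 + R / w a)⁻¹ * (1 + R / w (a + 1))⁻¹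

lemma lossFactor_pos (hw : ∀ k, 0 < w k) {R : ℝ} (hR : 0 ≤ R) (a : ℕ) : 0 < lossFactor w R a := by
  have := hw a
  have := hw (a + 1)
  unfold lossFactor; positivity

/-- The event `D` at time `t`, followed by a step to `y` and a step to `x`. -/
def roundTrip (I : ℕ → Ω → V) (t : ℕ) (x y : V) (D : Set Ω) : Set Ω :=
  D ∩ {ω | I (t + 1) ω = y} ∩ {ω | I (t + 1 + 1) ω = x}

lemma measurableSet_roundTrip {t : ℕ} {D : Set Ω} (hD : MeasurableSet[history I t] D) (x y : V) :
    MeasurableSet[history I (t + 1 + 1)] (roundTrip I t x y D) :=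
  ((history_mono (by omega) _ hD).inter (measurableSet_history_eq (by omega) y)).inter
    (measurableSet_history_eq le_rfl x)

lemma roundTrip_subset {t : ℕ} {x : V} {n : Sym2 V → ℕ} {D : Set Ω}
    (hsub : D ⊆ stateSet ℓ₀ I t x n) (y : V) :
    roundTrip I t x y D ⊆ stateSet ℓ₀ I (t + 1 + 1) x (n + Pi.single s(x, y) 2) := by
  have h1 : D ∩ {ω | I (t + 1) ω = y} ⊆ stateSet ℓ₀ I (t + 1) y (n + Pi.single s(x, y) 1) :=
    (Set.inter_subset_inter_left _ hsub).trans (stateSet_inter_subset t x y n)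
  refine (Set.inter_subset_inter_left _ h1).trans ((stateSet_inter_subset _ _ _ _).trans ?_)
  have h' : (Pi.single s(x, y) 2 : Sym2 V → ℕ) = Pi.single s(x, y) 1 + Pi.single s(x, y) 1 :=
    Pi.single_add _ 1 1
  rw [Sym2.eq_swap (a := y), h', ← add_assoc n]

/-- While only the edges to `y` and `z` have been crossed, all other edges keep their counts in
`n₀`, with total weight at most `R`. They disturb the urn probability `A / (A + B)` at the departure
from `x`, and are the only competitors at the return from `y`. -/
lemma IsERRW.le_measureReal_roundTrip (hI : IsERRW G w ℓ₀ v₀ P I) (hw : ∀ k, 0 < w k)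
    {x y z : V} (hxy : G.Adj x y) (hyz : y ≠ z) {n₀ n : Sym2 V → ℕ}
    (hn : ∀ g, g ≠ s(x, y) → g ≠ s(x, z) → n g = n₀ g) {t : ℕ} {D : Set Ω}
    (hD : MeasurableSet[history I t] D) (hsub : D ⊆ stateSet ℓ₀ I t x n) :
    P.real D * (lossFactor w (∑ u, ∑ v, w (n₀ s(u, v))) (n s(x, y)) *
      (w (n s(x, y)) / (w (n s(x, y)) + w (n s(x, z))))) ≤ P.real (roundTrip I t x y D) := by
  set R := ∑ u, ∑ v, w (n₀ s(u, v)) with hR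
  have hR0 : 0 ≤ R := Finset.sum_nonneg fun _ _ => Finset.sum_nonneg fun _ _ => (hw _).le
  set n' : Sym2 V → ℕ := n + Pi.single s(x, y) 1 with hn'
  have hD1 : MeasurableSet[history I (t + 1)] (D ∩ {ω | I (t + 1) ω = y}) :=
    (history_mono (by omega) _ hD).inter (measurableSet_history_eq le_rfl y)
  have hsub1 : D ∩ {ω | I (t + 1) ω = y} ⊆ stateSet ℓ₀ I (t + 1) y n' :=
    (Set.inter_subset_inter_left _ hsub).trans (stateSet_inter_subset t x y n)
  rw [roundTrip, hI.measureReal_inter_of_adj hD1 hsub1 hxy.symm,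
    hI.measureReal_inter_of_adj hD hsub hxy, mul_assoc]
  refine mul_le_mul_of_nonneg_left ?_ measureReal_nonneg
  have hWx := vertexWeight_pos hw hxy n
  have hWy := vertexWeight_pos hw hxy.symm n'
  have e1 : n' s(y, x) = n s(x, y) + 1 := by rw [Sym2.eq_swap]; simp [hn']
  have e2 : n' s(x, y) = n s(x, y) + 1 := by simp [hn']
  have hbx : vertexWeight G w n x ≤ R + w (n s(x, y)) + w (n s(x, z)) := by
    have := vertexWeight_le_of_frozen (G := G) hw hn x
    simpa using this
  have hby : vertexWeight G w n' y ≤ R + w (n s(x, y) + 1) := by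
    have hfro : ∀ g, g ≠ s(x, y) → g ≠ s(x, z) → n' g = n₀ g := by
      intro g h1 h2
      rw [← hn g h1 h2]; simp [hn', h1]
    have := vertexWeight_le_of_frozen (G := G) hw hfro y
    rw [e2] at this
    simpa [hxy.ne.symm, hyz] using this
  have hA := hw (n s(x, y))
  have hA' := hw (n s(x, y) + 1)
  have hB := hw (n s(x, z))
  rw [e1]
  set A := w (n s(x, y))
  set A' := w (n s(x, y) + 1)
  set B := w (n s(x, z))
  calc lossFactor w R (n s(x, y)) * (A / (A + B))
      = ((1 + R / A)⁻¹ * (A / (A + B))) * (1 + R / A')⁻¹ := by rw [lossFactor]; ring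
    _ ≤ (A / (R + A + B)) * (A' / (R + A')) := by
        refine mul_le_mul ?_ (le_of_eq ?_) (by positivity) (by positivity)
        · rw [inv_mul_eq_div, div_div]
          refine div_le_div_of_nonneg_left hA.le (by positivity) ?_
          -- The competition of `R` is charged to `A` alone, so the loss does not depend on the
          -- state of the other edge.
          have : (A + B) * (1 + R / A) = R + A + B + B * R / A := by field_simp; ring
          rw [this]
          have : 0 ≤ B * R / A := by positivity
          linarith
        · field_simp; ring
    _ ≤ _ := by gcongr

lemma IsERRW.exists_stateSet_pos (hI : IsERRW G w ℓ₀ v₀ P I) (hw : ∀ k, 0 < w k)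
    (hconn : G.Connected) (x : V) : ∃ t n, 0 < P.real (stateSet ℓ₀ I t x n) := by
  have hreach := hconn.preconnected v₀ x
  rw [SimpleGraph.reachable_iff_reflTransGen] at hreach
  induction hreach with
  | refl =>
    refine ⟨0, ℓ₀, ?_⟩
    have : P.real (stateSet ℓ₀ I 0 v₀ ℓ₀) = 1 := by
      rw [measureReal_def, (prob_compl_eq_zero_iff ?_).1 ?_, ENNReal.toReal_one]
      · exact hI.history_le 0 _ (measurableSet_stateSet 0 v₀ ℓ₀)
      · refine measure_mono_null ?_ hI.initial
        intro ω hω h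
        exact hω ⟨h, edgeWeight_zero _ _⟩
    rw [this]; exact one_pos
  | @tail b c _ hbc ih =>
    obtain ⟨t, n, h⟩ := ih
    refine ⟨t + 1, _, lt_of_lt_of_le ?_ (measureReal_mono (stateSet_inter_subset t b c n))⟩
    rw [hI.measureReal_inter_of_adj (measurableSet_stateSet t _ n) subset_rfl hbc]
    exact mul_pos h (div_pos (hw _) (vertexWeight_pos hw hbc n))

end Walk

lemma sum_inv_le_tsum {w : ℕ → ℝ} (hw : ∀ k, 0 < w k) (hs : Summable fun k => (w k)⁻¹) (a : ℕ)
    (s : Finset ℕ) : ∑ i ∈ s, (w (a + 2 * i))⁻¹ ≤ ∑' k, (w k)⁻¹ := by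
  have hinj : Function.Injective fun i : ℕ => a + 2 * i := fun i j h => by
    simp only at h; omega
  rw [← Finset.sum_image (f := fun k => (w k)⁻¹) (g := fun i => a + 2 * i)
    (fun i _ j _ h => hinj h)]
  exact hs.sum_le_tsum _ fun _ _ => (inv_pos.2 (hw _)).le

/-- Since `∑ 1 / w` converges, the losses to other edges multiply up to a positive constant. -/
lemma exp_neg_le_prod_lossFactor {w : ℕ → ℝ} (hw : ∀ k, 0 < w k)
    (hs : Summable fun k => (w k)⁻¹) {R : ℝ} (hR : 0 ≤ R) (a : ℕ) (s : Finset ℕ) :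
    Real.exp (-(R * ∑' k, (w k)⁻¹)) * Real.exp (-(R * ∑' k, (w k)⁻¹)) ≤
      ∏ i ∈ s, lossFactor w R (a + 2 * i) := by
  have h1 : ∀ b, Real.exp (-(R * ∑' k, (w k)⁻¹)) ≤ ∏ i ∈ s, (1 + R / w (b + 2 * i))⁻¹ := by
    intro b
    refine exp_neg_le_prod_inv (fun i => div_nonneg hR (hw _).le) ?_
    simp_rw [div_eq_mul_inv, ← Finset.mul_sum]
    exact mul_le_mul_of_nonneg_left (sum_inv_le_tsum hw hs b s) hR
  simp only [lossFactor, Finset.prod_mul_distrib]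
  refine mul_le_mul (h1 a) ?_ (Real.exp_pos _).le ((Real.exp_pos _).le.trans (h1 a))
  have := h1 (a + 1)
  simpa only [add_right_comm a 1] using this

/-! ### Urn states visited by the walk and late attraction -/

section Walk

variable {V : Type*} [Fintype V] [DecidableEq V] [MeasurableSpace V] [DiscreteMeasurableSpace V]
variable {Ω : Type*} [MeasurableSpace Ω]
variable {G : SimpleGraph V} [DecidableRel G.Adj] {w : ℕ → ℝ} {ℓ₀ : Sym2 V → ℕ} {v₀ : V}
  {P : Measure Ω} {I : ℕ → Ω → V}

/-- The event that the walk is at `x` at time `t₁ + 2 * (i + j)`, with the edge counts obtained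
from `n₀` by `i` round trips to `y` and `j` round trips to `z`. -/
def urnSet (ℓ₀ : Sym2 V → ℕ) (I : ℕ → Ω → V) (t₁ : ℕ) (n₀ : Sym2 V → ℕ) (x y z : V) (i j : ℕ) :
    Set Ω :=
  stateSet ℓ₀ I (t₁ + 2 * (i + j)) x
    (n₀ + Pi.single s(x, y) (2 * i) + Pi.single s(x, z) (2 * j))

variable {t₁ : ℕ} {n₀ : Sym2 V → ℕ} {x y z : V}

lemma urnSet_swap (i j : ℕ) : urnSet ℓ₀ I t₁ n₀ x y z i j = urnSet ℓ₀ I t₁ n₀ x z y j i := by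
  unfold urnSet
  rw [add_comm i j, add_right_comm]

lemma roundTrip_subset_urnSet {i j : ℕ} {D : Set Ω} (hsub : D ⊆ urnSet ℓ₀ I t₁ n₀ x y z i j) :
    roundTrip I (t₁ + 2 * (i + j)) x y D ⊆ urnSet ℓ₀ I t₁ n₀ x y z (i + 1) j := by
  refine (roundTrip_subset hsub y).trans (subset_of_eq ?_)
  unfold urnSet
  have h' : (Pi.single s(x, y) (2 * (i + 1)) : Sym2 V → ℕ) =
      Pi.single s(x, y) (2 * i) + Pi.single s(x, y) 2 := by
    rw [mul_add, mul_one]; exact Pi.single_add _ _ _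
  have h1 : n₀ + Pi.single s(x, y) (2 * i) + Pi.single s(x, z) (2 * j) + Pi.single s(x, y) 2 =
      n₀ + Pi.single s(x, y) (2 * (i + 1)) + Pi.single s(x, z) (2 * j) := by
    rw [h']; abel
  have h2 : t₁ + 2 * (i + j) + 1 + 1 = t₁ + 2 * (i + 1 + j) := by ring
  rw [h1, h2]

lemma measurableSet_urnSet (i j : ℕ) :
    MeasurableSet[history I (t₁ + 2 * (i + j))] (urnSet ℓ₀ I t₁ n₀ x y z i j) :=
  measurableSet_stateSet _ _ _

variable [IsProbabilityMeasure P]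

lemma IsERRW.le_measureReal_roundTrip_urnSet (hI : IsERRW G w ℓ₀ v₀ P I) (hw : ∀ k, 0 < w k)
    (hxy : G.Adj x y) (hyz : y ≠ z) {i j : ℕ} {D : Set Ω}
    (hD : MeasurableSet[history I (t₁ + 2 * (i + j))] D)
    (hsub : D ⊆ urnSet ℓ₀ I t₁ n₀ x y z i j) :
    P.real D * (lossFactor w (∑ u, ∑ v, w (n₀ s(u, v))) (n₀ s(x, y) + 2 * i) *
      (w (n₀ s(x, y) + 2 * i) / (w (n₀ s(x, y) + 2 * i) + w (n₀ s(x, z) + 2 * j)))) ≤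
      P.real (roundTrip I (t₁ + 2 * (i + j)) x y D) := by
  have hne : s(x, y) ≠ s(x, z) := fun h => hyz (Sym2.congr_right.1 h)
  have := hI.le_measureReal_roundTrip hw hxy hyz (n₀ := n₀) ?_ hD hsub
  · simpa [hne, hne.symm] using this
  · intro g h1 h2
    simp [h1, h2]

/-- Round trips to `y` and to `z` are the two colours of the urn of `exists_le_of_urn_recursion`. -/
lemma IsERRW.exists_le_measureReal_urnSet (hI : IsERRW G w ℓ₀ v₀ P I) (hw : ∀ k, 0 < w k)
    (hs : Summable fun k => (w k)⁻¹) (hxy : G.Adj x y) (hxz : G.Adj x z) (hyz : y ≠ z)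
    (hpos : 0 < P.real (stateSet ℓ₀ I t₁ x n₀)) :
    ∃ c : ℝ, 0 < c ∧ ∀ i j, c * ((w (n₀ s(x, y) + 2 * i))⁻¹ + (w (n₀ s(x, z) + 2 * j))⁻¹) ≤
      P.real (urnSet ℓ₀ I t₁ n₀ x y z i j) := by
  set R := ∑ u, ∑ v, w (n₀ s(u, v)) with hR
  have hR0 : 0 ≤ R := Finset.sum_nonneg fun _ _ => Finset.sum_nonneg fun _ _ => (hw _).le
  have hy : ∀ i j, P.real (urnSet ℓ₀ I t₁ n₀ x y z i j) *
      (lossFactor w R (n₀ s(x, y) + 2 * i) * (w (n₀ s(x, y) + 2 * i) /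
        (w (n₀ s(x, y) + 2 * i) + w (n₀ s(x, z) + 2 * j)))) ≤
      P.real (roundTrip I (t₁ + 2 * (i + j)) x y (urnSet ℓ₀ I t₁ n₀ x y z i j)) := fun i j =>
    hI.le_measureReal_roundTrip_urnSet hw hxy hyz (measurableSet_urnSet i j) subset_rfl
  have hz : ∀ i j, P.real (urnSet ℓ₀ I t₁ n₀ x y z i j) *
      (lossFactor w R (n₀ s(x, z) + 2 * j) * (w (n₀ s(x, z) + 2 * j) /
        (w (n₀ s(x, y) + 2 * i) + w (n₀ s(x, z) + 2 * j)))) ≤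
      P.real (roundTrip I (t₁ + 2 * (j + i)) x z (urnSet ℓ₀ I t₁ n₀ x z y j i)) := by
    intro i j
    have := hI.le_measureReal_roundTrip_urnSet hw hxz hyz.symm
      (measurableSet_urnSet (ℓ₀ := ℓ₀) (t₁ := t₁) (n₀ := n₀) j i) subset_rfl
    rw [← hR, add_comm (w (n₀ s(x, z) + 2 * j))] at this
    rwa [urnSet_swap i j]
  have hzsub : ∀ i j, roundTrip I (t₁ + 2 * (j + i)) x z (urnSet ℓ₀ I t₁ n₀ x z y j i) ⊆
      urnSet ℓ₀ I t₁ n₀ x y z i (j + 1) := by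
    intro i j
    rw [urnSet_swap i (j + 1)]
    exact roundTrip_subset_urnSet subset_rfl
  refine exists_le_of_urn_recursion
    (p := fun i j => P.real (urnSet ℓ₀ I t₁ n₀ x y z i j))
    (A := fun i => w (n₀ s(x, y) + 2 * i)) (B := fun j => w (n₀ s(x, z) + 2 * j))
    (κ := fun i => lossFactor w R (n₀ s(x, y) + 2 * i))
    (κ' := fun j => lossFactor w R (n₀ s(x, z) + 2 * j))
    (fun _ => hw _) (fun _ => hw _) (fun _ => lossFactor_pos hw hR0 _)
    (fun _ => lossFactor_pos hw hR0 _) ?_ ?_ ?_ ?_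
    (mul_pos (Real.exp_pos _) (Real.exp_pos _))
    (fun n => exp_neg_le_prod_lossFactor hw hs hR0 _ _)
    (fun n => exp_neg_le_prod_lossFactor hw hs hR0 _ _)
    (fun n => sum_inv_le_tsum hw hs _ _) (fun n => sum_inv_le_tsum hw hs _ _)
  · simpa [urnSet] using hpos
  · exact fun i j => (hy i j).trans (measureReal_mono (roundTrip_subset_urnSet subset_rfl))
  · exact fun i j => (hz i j).trans (measureReal_mono (hzsub i j))
  · intro i j
    refine (add_le_add (hy i (j + 1)) (hz (i + 1) j)).trans ?_
    rw [← measureReal_union]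
    · exact measureReal_mono (Set.union_subset (roundTrip_subset_urnSet subset_rfl)
        (hzsub (i + 1) j))
    -- Both events start from the same time, and the next vertex is `y` in one and `z` in the other.
    · rw [Set.disjoint_left]
      rintro ω ⟨⟨_, h1⟩, _⟩ ⟨⟨_, h2⟩, _⟩
      change I (t₁ + 2 * (i + (j + 1)) + 1) ω = y at h1
      change I (t₁ + 2 * (j + (i + 1)) + 1) ω = z at h2
      rw [show j + (i + 1) = i + (j + 1) by ring] at h2
      exact hyz (h1.symm.trans h2)
    · exact hI.history_le _ _ (measurableSet_roundTrip (measurableSet_urnSet j (i + 1)) x z)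

/-- The event that the walk makes a round trip to `z` after `i` round trips to `y`, after which it
makes round trips to `y` only until there are `M` of them. -/
def visitSet (ℓ₀ : Sym2 V → ℕ) (I : ℕ → Ω → V) (t₁ : ℕ) (n₀ : Sym2 V → ℕ) (x y z : V)
    (M i j : ℕ) : Set Ω :=
  urnSet ℓ₀ I t₁ n₀ x y z i j ∩ urnSet ℓ₀ I t₁ n₀ x y z i (j + 1) ∩
    urnSet ℓ₀ I t₁ n₀ x y z M (j + 1)

lemma IsERRW.measurableSet_visitSet (hI : IsERRW G w ℓ₀ v₀ P I) (M i j : ℕ) :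
    MeasurableSet (visitSet ℓ₀ I t₁ n₀ x y z M i j) :=
  ((hI.history_le _ _ (measurableSet_urnSet _ _)).inter
    (hI.history_le _ _ (measurableSet_urnSet _ _))).inter
    (hI.history_le _ _ (measurableSet_urnSet _ _))

/-- `D` prescribes one particular path: a round trip to `z`, then `k` round trips to `y`. It is
built step by step so that the round-trip bound can be iterated. -/
lemma IsERRW.exists_subset_visitSet (hI : IsERRW G w ℓ₀ v₀ P I) (hw : ∀ k, 0 < w k)
    (hxy : G.Adj x y) (hxz : G.Adj x z) (hyz : y ≠ z) {R : ℝ}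
    (hR : R = ∑ u, ∑ v, w (n₀ s(u, v))) (i j k : ℕ) :
    ∃ D : Set Ω, MeasurableSet[history I (t₁ + 2 * (i + k + (j + 1)))] D ∧
      D ⊆ visitSet ℓ₀ I t₁ n₀ x y z (i + k) i j ∧
      P.real (urnSet ℓ₀ I t₁ n₀ x y z i j) * (lossFactor w R (n₀ s(x, z) + 2 * j) *
        (w (n₀ s(x, z) + 2 * j) / (w (n₀ s(x, y) + 2 * i) + w (n₀ s(x, z) + 2 * j)))) *
        ∏ i' ∈ Finset.Ico i (i + k), (lossFactor w R (n₀ s(x, y) + 2 * i') *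
          (w (n₀ s(x, y) + 2 * i') /
            (w (n₀ s(x, y) + 2 * i') + w (n₀ s(x, z) + 2 * (j + 1))))) ≤ P.real D := by
  induction k with
  | zero =>
    have hm : MeasurableSet[history I (t₁ + 2 * (j + i))] (urnSet ℓ₀ I t₁ n₀ x z y j i) :=
      measurableSet_urnSet j i
    refine ⟨roundTrip I (t₁ + 2 * (j + i)) x z (urnSet ℓ₀ I t₁ n₀ x z y j i), ?_, ?_, ?_⟩
    · exact history_mono (by omega) _ (measurableSet_roundTrip hm x z)
    · have h1 : roundTrip I (t₁ + 2 * (j + i)) x z (urnSet ℓ₀ I t₁ n₀ x z y j i) ⊆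
          urnSet ℓ₀ I t₁ n₀ x y z i (j + 1) := by
        rw [urnSet_swap i (j + 1)]
        exact roundTrip_subset_urnSet subset_rfl
      refine Set.subset_inter (Set.subset_inter ?_ h1) h1
      rw [urnSet_swap i j]
      exact fun ω hω => hω.1.1
    · have := hI.le_measureReal_roundTrip_urnSet hw hxz hyz.symm hm subset_rfl
      rw [← hR, add_comm (w (n₀ s(x, z) + 2 * j)), ← urnSet_swap i j] at this
      simpa [urnSet_swap i j] using this
  | succ k ih =>
    obtain ⟨D, hD, hsub, hle⟩ := ih
    refine ⟨roundTrip I (t₁ + 2 * (i + k + (j + 1))) x y D, ?_, ?_, ?_⟩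
    · have := measurableSet_roundTrip hD x y
      exact history_mono (by omega) _ this
    · refine Set.subset_inter (fun ω hω => (hsub hω.1.1).1) ?_
      exact roundTrip_subset_urnSet fun ω hω => (hsub hω).2
    · refine le_trans ?_ (hI.le_measureReal_roundTrip_urnSet hw hxy hyz hD
        fun ω hω => (hsub hω).2)
      rw [← add_assoc i k 1, Finset.prod_Ico_succ_top (by omega), ← mul_assoc, ← hR]
      refine mul_le_mul_of_nonneg_right hle ?_
      have h1 := hw (n₀ s(x, y) + 2 * (i + k))
      have h2 := hw (n₀ s(x, z) + 2 * (j + 1))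
      have h3 := lossFactor_pos hw (R := R) (by
        rw [hR]; exact Finset.sum_nonneg fun _ _ => Finset.sum_nonneg fun _ _ => (hw _).le)
        (n₀ s(x, y) + 2 * (i + k))
      positivity

/-- Multiplying the visiting bound by the chance of a round trip to `z` gives `(1 / A + 1 / B) * B /
(A + B) = 1 / A`, free of `j`. The exponential bounds the chance of only round trips to `y` from
then on. Its sum starts at `N` rather than `i` to be uniform in `i`. -/
lemma IsERRW.exists_le_measureReal_visitSet (hI : IsERRW G w ℓ₀ v₀ P I) (hw : ∀ k, 0 < w k)
    (hs : Summable fun k => (w k)⁻¹) (hxy : G.Adj x y) (hxz : G.Adj x z) (hyz : y ≠ z)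
    (hpos : 0 < P.real (stateSet ℓ₀ I t₁ x n₀)) :
    ∃ c : ℝ, 0 < c ∧ ∀ N M i j, N ≤ i → i ≤ M →
      c * (w (n₀ s(x, y) + 2 * i))⁻¹ * Real.exp (-(w (n₀ s(x, z) + 2 * (j + 1)) *
        ∑ i' ∈ Finset.Ico N M, (w (n₀ s(x, y) + 2 * i'))⁻¹)) ≤
      P.real (visitSet ℓ₀ I t₁ n₀ x y z M i j) := by
  obtain ⟨c, hc0, hc⟩ := hI.exists_le_measureReal_urnSet hw hs hxy hxz hyz hpos
  set R := ∑ u, ∑ v, w (n₀ s(u, v)) with hR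
  have hR0 : 0 ≤ R := Finset.sum_nonneg fun _ _ => Finset.sum_nonneg fun _ _ => (hw _).le
  set E := Real.exp (-(R * ∑' k, (w k)⁻¹)) * Real.exp (-(R * ∑' k, (w k)⁻¹)) with hE
  have hE0 : 0 < E := mul_pos (Real.exp_pos _) (Real.exp_pos _)
  refine ⟨c * E * E, by positivity, fun N M i j hNi hiM => ?_⟩
  obtain ⟨k, rfl⟩ := Nat.exists_eq_add_of_le hiM
  obtain ⟨D, -, hsub, hle⟩ := hI.exists_subset_visitSet (t₁ := t₁) hw hxy hxz hyz hR i j k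
  refine le_trans ?_ (hle.trans (measureReal_mono hsub))
  have hA := hw (n₀ s(x, y) + 2 * i)
  have hB := hw (n₀ s(x, z) + 2 * j)
  have hB1 := hw (n₀ s(x, z) + 2 * (j + 1))
  have h1 : E ≤ lossFactor w R (n₀ s(x, z) + 2 * j) := by
    have := exp_neg_le_prod_lossFactor hw hs hR0 (n₀ s(x, z)) {j}
    simpa using this
  have h2 : c * (w (n₀ s(x, y) + 2 * i))⁻¹ * E ≤ P.real (urnSet ℓ₀ I t₁ n₀ x y z i j) *
      (lossFactor w R (n₀ s(x, z) + 2 * j) *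
        (w (n₀ s(x, z) + 2 * j) / (w (n₀ s(x, y) + 2 * i) + w (n₀ s(x, z) + 2 * j)))) := by
    have hf : 0 ≤ w (n₀ s(x, z) + 2 * j) /
      (w (n₀ s(x, y) + 2 * i) + w (n₀ s(x, z) + 2 * j)) := by positivity
    refine le_trans (le_of_eq ?_) (mul_le_mul (hc i j) (mul_le_mul_of_nonneg_right h1 hf)
      (by positivity) measureReal_nonneg)
    field_simp
    ring
  have h3 : E * Real.exp (-(w (n₀ s(x, z) + 2 * (j + 1)) *
        ∑ i' ∈ Finset.Ico N (i + k), (w (n₀ s(x, y) + 2 * i'))⁻¹)) ≤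
      ∏ i' ∈ Finset.Ico i (i + k), (lossFactor w R (n₀ s(x, y) + 2 * i') *
          (w (n₀ s(x, y) + 2 * i') /
            (w (n₀ s(x, y) + 2 * i') + w (n₀ s(x, z) + 2 * (j + 1))))) := by
    rw [Finset.prod_mul_distrib]
    refine mul_le_mul (exp_neg_le_prod_lossFactor hw hs hR0 _ _) ?_ (Real.exp_pos _).le
      (Finset.prod_nonneg fun _ _ => (lossFactor_pos hw hR0 _).le)
    have h4 : ∀ i', w (n₀ s(x, y) + 2 * i') / (w (n₀ s(x, y) + 2 * i') +
        w (n₀ s(x, z) + 2 * (j + 1))) =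
        (1 + w (n₀ s(x, z) + 2 * (j + 1)) / w (n₀ s(x, y) + 2 * i'))⁻¹ := by
      intro i'
      have := hw (n₀ s(x, y) + 2 * i')
      field_simp
    simp_rw [h4]
    refine exp_neg_le_prod_inv (fun i' => (div_pos hB1 (hw _)).le) ?_
    simp_rw [div_eq_mul_inv, ← Finset.mul_sum]
    refine mul_le_mul_of_nonneg_left ?_ hB1.le
    exact Finset.sum_le_sum_of_subset_of_nonneg (Finset.Ico_subset_Ico_left hNi)
      fun _ _ _ => (inv_pos.2 (hw _)).le
  refine le_trans (le_of_eq ?_) (mul_le_mul h2 h3 (by positivity) ?_)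
  · ring
  · exact le_trans (by positivity) h2

/-- Counts grow along a trajectory, so the urn states it visits form a chain. This makes the events
`visitSet` for different `(i, j)` disjoint: a path has one last round trip to `z` before `M` is
reached. -/
lemma le_and_le_or_of_mem_urnSet (hyz : y ≠ z) {ω : Ω} {i j i' j' : ℕ}
    (h : ω ∈ urnSet ℓ₀ I t₁ n₀ x y z i j) (h' : ω ∈ urnSet ℓ₀ I t₁ n₀ x y z i' j') :
    (i ≤ i' ∧ j ≤ j') ∨ (i' ≤ i ∧ j' ≤ j) := by
  have hne : s(x, y) ≠ s(x, z) := fun h => hyz (Sym2.congr_right.1 h)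
  have key : ∀ {i j i' j' : ℕ}, ω ∈ urnSet ℓ₀ I t₁ n₀ x y z i j →
      ω ∈ urnSet ℓ₀ I t₁ n₀ x y z i' j' → t₁ + 2 * (i + j) ≤ t₁ + 2 * (i' + j') →
      i ≤ i' ∧ j ≤ j' := by
    intro i j i' j' h h' hle
    have hm := edgeWeight_mono ℓ₀ (fun n => I n ω) hle
    rw [h.2, h'.2] at hm
    have h1 := hm s(x, y)
    have h2 := hm s(x, z)
    simp [hne, hne.symm] at h1 h2
    omega
  rcases le_total (t₁ + 2 * (i + j)) (t₁ + 2 * (i' + j')) with hle | hle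
  · exact Or.inl (key h h' hle)
  · exact Or.inr (key h' h hle)

lemma visitSet_disjoint (hyz : y ≠ z) {M i j i' j' : ℕ} (hi : i < M) (hi' : i' < M)
    (hne : (i, j) ≠ (i', j')) :
    Disjoint (visitSet ℓ₀ I t₁ n₀ x y z M i j) (visitSet ℓ₀ I t₁ n₀ x y z M i' j') := by
  rw [Set.disjoint_left]
  rintro ω ⟨⟨h1, h2⟩, h3⟩ ⟨⟨h1', h2'⟩, h3'⟩
  have e1 := le_and_le_or_of_mem_urnSet hyz h2 h1'
  have e2 := le_and_le_or_of_mem_urnSet hyz h1 h2'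
  have e3 := le_and_le_or_of_mem_urnSet hyz h3 h2'
  have e4 := le_and_le_or_of_mem_urnSet hyz h2 h3'
  refine hne ?_
  rw [Prod.mk.injEq]
  omega

/-- Were the walk attracted by step `i`, a single edge would be crossed from `t₁ + 2 * (i + j) ≥ i`
on. But the count of `s(x, z)` grows there, and later, as `i < M`, so does that of `s(x, y)`. -/
lemma le_attractionTime_of_mem_visitSet (hyz : y ≠ z) {M i j : ℕ} (hi : i < M) {ω : Ω}
    (h : ω ∈ visitSet ℓ₀ I t₁ n₀ x y z M i j) :
    ((i + 1 : ℕ) : ℕ∞) ≤ attractionTime G ℓ₀ fun n => I n ω := by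
  have hne : s(x, y) ≠ s(x, z) := fun h => hyz (Sym2.congr_right.1 h)
  refine le_add_left (le_iInf₂ fun k hk => ?_)
  by_contra hlt
  have hki : k ≤ t₁ + 2 * (i + j) := by
    have : k < i + 1 := by exact_mod_cast not_le.1 hlt
    omega
  obtain ⟨⟨h1, h2⟩, h3⟩ := h
  set τ := t₁ + 2 * (i + j) with hτ
  have hconst : ∀ m, s(I (τ + m) ω, I (τ + m + 1) ω) = s(I τ ω, I (τ + 1) ω) := by
    intro m
    induction m with
    | zero => rfl
    | succ m ih =>
      rw [← ih]
      exact (hk (τ + m) (by omega)).symm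
  have hcount : ∀ m, edgeWeight ℓ₀ (fun n => I n ω) (τ + m) =
      edgeWeight ℓ₀ (fun n => I n ω) τ + Pi.single s(I τ ω, I (τ + 1) ω) m := by
    intro m
    induction m with
    | zero => simp
    | succ m ih =>
      have h' : (Pi.single s(I τ ω, I (τ + 1) ω) (m + 1) : Sym2 V → ℕ) =
        Pi.single s(I τ ω, I (τ + 1) ω) m + Pi.single s(I τ ω, I (τ + 1) ω) 1 :=
          Pi.single_add _ _ _
      rw [← add_assoc τ, edgeWeight_succ, ih, hconst m, h', ← add_assoc (edgeWeight _ _ _)]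
  have c1 := hcount 2
  have c2 := hcount (2 * (M - i) + 2)
  rw [show τ + 2 = t₁ + 2 * (i + (j + 1)) by omega, h2.2, h1.2] at c1
  rw [show τ + (2 * (M - i) + 2) = t₁ + 2 * (M + (j + 1)) by omega, h3.2, h1.2] at c2
  have d1 := congrFun c1 s(x, z)
  have d2 := congrFun c2 s(x, y)
  simp only [Pi.add_apply, Pi.single_eq_same, Pi.single_eq_of_ne hne,
    Pi.single_eq_of_ne hne.symm, add_zero] at d1 d2
  by_cases hg : s(x, z) = s(I τ ω, I (τ + 1) ω)
  · rw [← hg, Pi.single_eq_of_ne hne] at d2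
    omega
  · rw [Pi.single_eq_of_ne hg] at d1
    omega

theorem IsERRW.exists_measurableSet_le_attractionTime (hI : IsERRW G w ℓ₀ v₀ P I)
    (hw : ∀ k, 0 < w k) (hs : Summable fun k => (w k)⁻¹) (hconn : G.Connected)
    (hxy : G.Adj x y) (hxz : G.Adj x z) (hyz : y ≠ z) :
    ∃ (a b : ℕ) (c : ℝ), 0 < c ∧ ∀ N M J : ℕ, ∃ D : Set Ω, MeasurableSet D ∧
      (∀ ω ∈ D, ((N + 1 : ℕ) : ℕ∞) ≤ attractionTime G ℓ₀ fun n => I n ω) ∧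
      ∑ i ∈ Finset.Ico N M, ∑ j ∈ Finset.range J, c * (w (a + 2 * i))⁻¹ *
        Real.exp (-(w (b + 2 * (j + 1)) * ∑ i' ∈ Finset.Ico N M, (w (a + 2 * i'))⁻¹)) ≤
      P.real D := by
  obtain ⟨t₁, n₀, hpos⟩ := hI.exists_stateSet_pos hw hconn x
  obtain ⟨c, hc0, hc⟩ := hI.exists_le_measureReal_visitSet hw hs hxy hxz hyz hpos
  refine ⟨n₀ s(x, y), n₀ s(x, z), c, hc0, fun N M J => ?_⟩
  refine ⟨⋃ p ∈ Finset.Ico N M ×ˢ Finset.range J, visitSet ℓ₀ I t₁ n₀ x y z M p.1 p.2, ?_, ?_, ?_⟩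
  · exact Finset.measurableSet_biUnion _ fun p _ => hI.measurableSet_visitSet M p.1 p.2
  · intro ω hω
    simp only [Set.mem_iUnion, Finset.mem_product, Finset.mem_Ico] at hω
    obtain ⟨p, ⟨⟨h1, h2⟩, -⟩, h⟩ := hω
    refine le_trans ?_ (le_attractionTime_of_mem_visitSet hyz h2 h)
    exact_mod_cast Nat.succ_le_succ h1
  · rw [measureReal_biUnion_finset, Finset.sum_product]
    · refine Finset.sum_le_sum fun i hi => Finset.sum_le_sum fun j _ => ?_
      rw [Finset.mem_Ico] at hi
      exact hc N M i j hi.1 hi.2.le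
    · intro p hp q hq hpq
      simp only [Finset.coe_product, Set.mem_prod, Finset.coe_Ico, Set.mem_Ico] at hp hq
      exact visitSet_disjoint hyz hp.1.2 hq.1.2 hpq
    · exact fun p _ => hI.measurableSet_visitSet M p.1 p.2

end Walk

/-! ### Size of the lower bound for regular weights -/

lemma summable_inv_of_comparable {ρ α C : ℝ} {w : ℕ → ℝ} (hρ : 1 < ρ) (hα : 0 ≤ α)
    (hw : ∀ k, 0 < w k) (hC1 : 1 ≤ C)
    (hC : ∀ k, w k ≤ C * refWeight ρ α k ∧ refWeight ρ α k ≤ C * w k) :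
    Summable fun k => (w k)⁻¹ := by
  have h1 : Summable fun k : ℕ => C * (((k : ℝ) + 2) ^ (-ρ) * Real.log (k + 2) ^ (-α)) :=
    (summable_rpow_mul_log hα (Or.inl hρ)).mul_left C
  refine Summable.of_nonneg_of_le (fun k => (inv_pos.2 (hw k)).le) (fun k => ?_) h1
  have hv := refWeight_pos (ρ := ρ) (α := α) k
  have hl := log_natCast_add_two_pos k
  have hx : (0 : ℝ) < (k : ℝ) + 2 := by positivity
  rw [Real.rpow_neg hx.le, Real.rpow_neg hl.le, ← mul_inv]
  change (w k)⁻¹ ≤ C * (refWeight ρ α k)⁻¹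
  rw [← div_eq_mul_inv, inv_le_comm₀ (hw k) (by positivity), inv_div, div_le_iff₀' (by linarith)]
  exact (hC k).2

/-- The lower bound for the probability of late attraction, for weights comparable with
`refWeight ρ α`. -/
lemma exists_le_sum_of_comparable {ρ α C : ℝ} {w : ℕ → ℝ} (hρ : 1 < ρ) (hα : 0 ≤ α)
    (hw : ∀ k, 0 < w k) (hC1 : 1 ≤ C)
    (hC : ∀ k, w k ≤ C * refWeight ρ α k ∧ refWeight ρ α k ≤ C * w k) (a b : ℕ) :
    ∃ c : ℝ, 0 < c ∧ ∀ N : ℕ, ∃ J : ℕ,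
      c * (((N : ℝ) + 2) ^ (-((ρ - 1) ^ 2 / ρ)) * Real.log (N + 2) ^ (-α)) ≤
      ∑ i ∈ Finset.Ico (N + 1) (2 * N + 2), ∑ j ∈ Finset.range J, (w (a + 2 * i))⁻¹ *
        Real.exp (-(w (b + 2 * (j + 1)) *
          ∑ i' ∈ Finset.Ico (N + 1) (2 * N + 2), (w (a + 2 * i'))⁻¹)) := by
  have hρ0 : 0 < ρ := by linarith
  have hC0 : 0 < C := by linarith
  have hv : ∀ k, 0 < refWeight ρ α k := fun k => refWeight_pos k
  set θ := 1 - 1 / ρ with hθ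
  have hθ0 : 0 < θ := by
    rw [hθ, sub_pos, div_lt_one hρ0]; linarith
  have hθ1 : θ ≤ 1 := by
    have : 0 < 1 / ρ := by positivity
    linarith
  -- Doubling constants: `a + 2 * i + 2 ≤ (a + 4) * (N + 2)` for `i ≤ 2 * N + 1`, and `b + 2 * (j +
  -- 1) + 2 ≤ (b + 4) * B` for `j + 1 ≤ B`.
  set D₁ : ℝ := ((a + 4 : ℕ) : ℝ) ^ ρ * (2 * (a + 4 : ℕ) : ℝ) ^ α with hD₁
  have hD₁0 : 0 < D₁ := by positivity
  set D₂ : ℝ := ((b : ℝ) + 4) ^ ρ * (2 * ((b : ℝ) + 4)) ^ α with hD₂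
  have hD₂0 : 0 < D₂ := by positivity
  refine ⟨(C * D₁)⁻¹ * Real.exp (-(C ^ 2 * D₂)) / 4, by positivity, fun N => ?_⟩
  set A : ℝ := (N : ℝ) + 2 with hA
  have hA2 : 2 ≤ A := by have : (0 : ℝ) ≤ N := by positivity
                         linarith
  have hA0 : 0 < A := by linarith
  have hlA : 0 < Real.log A := log_natCast_add_two_pos N
  have hlA2 : Real.log 2 ≤ Real.log A := log_two_le_log_natCast_add_two N
  set B : ℝ := A ^ θ with hB
  have hB1 : 1 ≤ B := Real.one_le_rpow (by linarith) hθ0.le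
  have hBA : B ≤ A := by
    calc B ≤ A ^ (1 : ℝ) := Real.rpow_le_rpow_of_exponent_le (by linarith) hθ1
      _ = A := Real.rpow_one A
  have hvN := hv N
  have hup : ∀ i ∈ Finset.Ico (N + 1) (2 * N + 2), (C * D₁ * refWeight ρ α N)⁻¹ ≤
      (w (a + 2 * i))⁻¹ := by
    intro i hi
    rw [Finset.mem_Ico] at hi
    refine inv_anti₀ (hw _) ((hC _).1.trans ?_)
    rw [mul_assoc]
    refine mul_le_mul_of_nonneg_left ?_ hC0.le
    refine refWeight_mul_le hρ0.le hα (c := a + 4) (by omega) _ _ ?_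
    nlinarith [Nat.zero_le (a * N)]
  have hlow : ∑ i' ∈ Finset.Ico (N + 1) (2 * N + 2), (w (a + 2 * i'))⁻¹ ≤
      A * (C / refWeight ρ α N) := by
    calc _ ≤ ∑ i' ∈ Finset.Ico (N + 1) (2 * N + 2), C / refWeight ρ α N := by
          refine Finset.sum_le_sum fun i hi => ?_
          rw [Finset.mem_Ico] at hi
          rw [inv_le_comm₀ (hw _) (by positivity), inv_div, div_le_iff₀' hC0]
          exact (refWeight_mono hρ0.le hα (by omega)).trans (hC _).2
      _ ≤ _ := by
          rw [Finset.sum_const, Nat.card_Ico, nsmul_eq_mul]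
          have h1 : ((2 * N + 2 - (N + 1) : ℕ) : ℝ) ≤ A := by
            have : 2 * N + 2 - (N + 1) = N + 1 := by omega
            rw [this, hA]; push_cast; linarith
          gcongr
  have hexp : ∀ j ∈ Finset.range ⌊B⌋₊, Real.exp (-(C ^ 2 * D₂)) ≤
      Real.exp (-(w (b + 2 * (j + 1)) *
          ∑ i' ∈ Finset.Ico (N + 1) (2 * N + 2), (w (a + 2 * i'))⁻¹)) := by
    intro j hj
    have hjB : (j : ℝ) + 1 ≤ B := by
      have : j + 1 ≤ ⌊B⌋₊ := by simpa using hj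
      have := (Nat.le_floor_iff (by linarith)).1 this
      exact_mod_cast this
    have hj0 : (0 : ℝ) ≤ j := by positivity
    have hb0 : (0 : ℝ) ≤ b := by positivity
    have hk : ((b + 2 * (j + 1) : ℕ) : ℝ) + 2 ≤ (b + 4) * B := by
      push_cast
      nlinarith
    have hlog : Real.log (((b + 2 * (j + 1) : ℕ) : ℝ) + 2) ≤ 2 * (b + 4) * Real.log A := by
      calc Real.log (((b + 2 * (j + 1) : ℕ) : ℝ) + 2) ≤ Real.log ((b + 4) * A) :=
            Real.log_le_log (by positivity) (hk.trans (by gcongr))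
        _ = Real.log (b + 4) + Real.log A := Real.log_mul (by positivity) (by positivity)
        _ ≤ (b + 4 - 1) + Real.log A := by
            gcongr; exact Real.log_le_sub_one_of_pos (by positivity)
        _ ≤ _ := by
            have := Real.log_two_gt_d9
            nlinarith
    have hvb : refWeight ρ α (b + 2 * (j + 1)) ≤ D₂ * (refWeight ρ α N / A) := by
      have hlk := log_natCast_add_two_pos (b + 2 * (j + 1))
      calc refWeight ρ α (b + 2 * (j + 1))
          ≤ ((b + 4) * B) ^ ρ * (2 * (b + 4) * Real.log A) ^ α := by
            unfold refWeight; gcongr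
        _ = D₂ * (B ^ ρ * Real.log A ^ α) := by
            rw [Real.mul_rpow (by positivity) (by positivity),
              Real.mul_rpow (by positivity) hlA.le, hD₂]
            ring
        _ = _ := by
            -- This identity dictates `B = A ^ (1 - 1/ρ)`: the second edge then has weight of order
            -- `w N / N`, the inverse of the sum of `1 / w` over the block, so the exponent stays
            -- bounded.
            have : B ^ ρ = A ^ ρ / A := by
              rw [hB, ← Real.rpow_mul hA0.le, ← Real.rpow_sub_one hA0.ne']
              congr 1; rw [hθ]; field_simp
            rw [this, refWeight, ← hA]; ring
    rw [Real.exp_le_exp, neg_le_neg_iff]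
    calc _ ≤ (C * (D₂ * (refWeight ρ α N / A))) * (A * (C / refWeight ρ α N)) := by
          refine mul_le_mul ((hC _).1.trans (mul_le_mul_of_nonneg_left hvb hC0.le)) hlow
            (Finset.sum_nonneg fun _ _ => (inv_pos.2 (hw _)).le) (by positivity)
      _ = _ := by field_simp
  -- About `A * B` pairs `(i, j)` remain, each contributing a multiple of `1 / w N`; the two
  -- halvings from integer rounding give the `4` in the constant.
  refine ⟨⌊B⌋₊, ?_⟩
  calc _ ≤ ∑ i ∈ Finset.Ico (N + 1) (2 * N + 2), ∑ j ∈ Finset.range ⌊B⌋₊,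
        (C * D₁ * refWeight ρ α N)⁻¹ * Real.exp (-(C ^ 2 * D₂)) := by
        simp only [Finset.sum_const, Nat.card_Ico, Finset.card_range, nsmul_eq_mul]
        have h1 : A / 2 ≤ ((2 * N + 2 - (N + 1) : ℕ) : ℝ) := by
          have : 2 * N + 2 - (N + 1) = N + 1 := by omega
          have hN : (0 : ℝ) ≤ N := by positivity
          rw [this, hA]; push_cast; linarith
        have h2 : B / 2 ≤ (⌊B⌋₊ : ℝ) := by
          have h3 := Nat.lt_floor_add_one B
          have h4 : (1 : ℝ) ≤ ⌊B⌋₊ := by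
            have : 1 ≤ ⌊B⌋₊ := (Nat.le_floor_iff (by linarith)).2 (by simpa using hB1)
            exact_mod_cast this
          linarith
        have h5 : A ^ (-((ρ - 1) ^ 2 / ρ)) * Real.log A ^ (-α) =
            A * B * (refWeight ρ α N)⁻¹ := by
          rw [refWeight, ← hA, Real.rpow_neg hlA.le, hB]
          have : -((ρ - 1) ^ 2 / ρ) = θ + (1 - ρ) := by rw [hθ]; field_simp; ring
          rw [this, Real.rpow_add hA0, Real.rpow_sub hA0 1 ρ, Real.rpow_one]
          field_simp
        rw [h5]
        calc _ = (A / 2) * ((B / 2) * ((C * D₁ * refWeight ρ α N)⁻¹ *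
              Real.exp (-(C ^ 2 * D₂)))) := by field_simp; ring
          _ ≤ _ := by gcongr
    _ ≤ _ := by
        refine Finset.sum_le_sum fun i hi => Finset.sum_le_sum fun j hj => ?_
        exact mul_le_mul (hup i hi) (hexp j hj) (Real.exp_pos _).le (inv_pos.2 (hw _)).le

/-- If every vertex had at most one neighbour, a connected graph could only consist of one edge. -/
lemma exists_adj_adj_ne {V : Type*} [Fintype V] [DecidableEq V] {G : SimpleGraph V}
    [DecidableRel G.Adj] (hconn : G.Connected) (hedges : 2 ≤ G.edgeFinset.card) :
    ∃ x y z, G.Adj x y ∧ G.Adj x z ∧ y ≠ z := by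
  by_contra! hno
  obtain ⟨e, he, f, hf, hef⟩ := Finset.one_lt_card.1 hedges
  induction e with | _ a b
  induction f with | _ c d
  simp only [SimpleGraph.mem_edgeFinset, SimpleGraph.mem_edgeSet] at he hf
  have hclosed : ∀ u, u = a ∨ u = b := by
    intro u
    have hreach := hconn.preconnected a u
    rw [SimpleGraph.reachable_iff_reflTransGen] at hreach
    induction hreach with
    | refl => exact Or.inl rfl
    | tail _ hadj ih =>
      rcases ih with rfl | rfl
      · exact Or.inr (hno _ _ _ hadj he)
      · exact Or.inl (hno _ _ _ hadj he.symm)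
  have hcd := hf.ne
  refine hef ?_
  rcases hclosed c with rfl | rfl <;> rcases hclosed d with rfl | rfl
  · exact absurd rfl hcd
  · rfl
  · exact Sym2.eq_swap
  · exact absurd rfl hcd

/-! ### Infinite expectation up to the threshold -/

section Walk

variable {V : Type*} [Fintype V] [DecidableEq V] [MeasurableSpace V] [DiscreteMeasurableSpace V]
variable {Ω : Type*} [MeasurableSpace Ω]
variable {G : SimpleGraph V} [DecidableRel G.Adj] {w : ℕ → ℝ} {ℓ₀ : Sym2 V → ℕ} {v₀ : V}
  {P : Measure Ω} {I : ℕ → Ω → V}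

/-- The number of events `D N` that occur is at most `T`. -/
lemma tsum_measure_le_expectedAttractionTime {D : ℕ → Set Ω} (hD : ∀ N, MeasurableSet (D N))
    (hle : ∀ N, ∀ ω ∈ D N, ((N + 1 : ℕ) : ℕ∞) ≤ attractionTime G ℓ₀ fun n => I n ω) :
    ∑' N, P (D N) ≤ expectedAttractionTime G ℓ₀ P I := by
  calc ∑' N, P (D N) = ∫⁻ ω, ∑' N, (D N).indicator (fun _ => (1 : ℝ≥0∞)) ω ∂P := by
        rw [lintegral_tsum fun N => (measurable_const.indicator (hD N)).aemeasurable]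
        refine tsum_congr fun N => ?_
        rw [lintegral_indicator_const (hD N), one_mul]
    _ ≤ _ := by
        refine lintegral_mono fun ω => ?_
        rcases eq_or_ne (attractionTime G ℓ₀ fun n => I n ω) ⊤ with htop | hne
        · simp [htop]
        · obtain ⟨t, ht⟩ := ENat.ne_top_iff_exists.1 hne
          have hzero : ∀ N ∉ Finset.range t, (D N).indicator (fun _ => (1 : ℝ≥0∞)) ω = 0 := by
            intro N hN
            refine Set.indicator_of_notMem (fun hω => hN ?_) _
            have := hle N ω hω
            rw [← ht] at this
            have : N + 1 ≤ t := by exact_mod_cast this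
            simp; omega
          rw [tsum_eq_sum hzero, ← ht]
          calc _ ≤ ∑ N ∈ Finset.range t, (1 : ℝ≥0∞) := by
                refine Finset.sum_le_sum fun N _ => ?_
                exact Set.indicator_le_self _ _ _
            _ = _ := by simp

variable [IsProbabilityMeasure P]

theorem IsERRW.expectedAttractionTime_eq_top_of_regular {ρ α : ℝ} (hI : IsERRW G w ℓ₀ v₀ P I)
    (hconn : G.Connected) (hedges : 2 ≤ G.edgeFinset.card) (hw : ∀ k, 0 < w k) (hρ : 1 < ρ)
    (hα : 0 ≤ α) (hwk : ∀ k : ℕ, 2 ≤ k → w k = (k : ℝ) ^ ρ * Real.log k ^ α)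
    (hγ : (ρ - 1) ^ 2 / ρ < 1 ∨ (ρ - 1) ^ 2 / ρ = 1 ∧ α ≤ 1) :
    expectedAttractionTime G ℓ₀ P I = ⊤ := by
  obtain ⟨C, hC1, hC⟩ := exists_comparable_refWeight (by linarith) hα hw hwk
  obtain ⟨x, y, z, hxy, hxz, hyz⟩ := exists_adj_adj_ne hconn hedges
  obtain ⟨a, b, c, hc0, h⟩ := hI.exists_measurableSet_le_attractionTime hw
    (summable_inv_of_comparable hρ hα hw hC1 hC) hconn hxy hxz hyz
  obtain ⟨c', hc'0, h'⟩ := exists_le_sum_of_comparable hρ hα hw hC1 hC a b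
  choose J hJ using h'
  choose D hDm hDle hDP using fun N : ℕ => h (N + 1) (2 * N + 2) (J N)
  have hsum := tsum_measure_le_expectedAttractionTime (P := P) (G := G) hDm fun N ω hω =>
    le_trans (by exact_mod_cast Nat.le_succ (N + 1)) (hDle N ω hω)
  rw [← top_le_iff]
  refine le_trans ?_ hsum
  rw [top_le_iff]
  by_contra hne
  refine not_summable_rpow_mul_log hα hγ ?_
  have hs : Summable fun N => P.real (D N) := ENNReal.summable_toReal hne
  refine Summable.of_nonneg_of_le (fun k => ?_) (fun N => ?_) (hs.mul_left (c * c')⁻¹)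
  · have := log_natCast_add_two_pos k
    positivity
  · rw [inv_mul_eq_div, le_div_iff₀' (by positivity), mul_assoc]
    refine le_trans (mul_le_mul_of_nonneg_left (hJ N) hc0.le) (le_trans (le_of_eq ?_) (hDP N))
    simp only [Finset.mul_sum, mul_assoc]

end Walk

/-! ### Arithmetic of the critical exponent -/

lemma sq_div_lt_one {ρ : ℝ} (hρ : 1 < ρ) (h : ρ < 1 + (1 + √5) / 2) : (ρ - 1) ^ 2 / ρ < 1 := by
  have h5 : √5 ^ 2 = 5 := Real.sq_sqrt (by norm_num)
  have h2 : 2 < √5 := by nlinarith [Real.sqrt_nonneg 5]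
  rw [div_lt_one (by linarith)]
  nlinarith

lemma sq_div_eq_one {ρ : ℝ} (h : ρ = 1 + (1 + √5) / 2) : (ρ - 1) ^ 2 / ρ = 1 := by
  have h5 : √5 ^ 2 = 5 := Real.sq_sqrt (by norm_num)
  have h2 := Real.sqrt_nonneg 5
  rw [div_eq_one_iff_eq (by linarith), h]
  nlinarith

lemma one_lt_sq_div {ρ : ℝ} (h : 1 + (1 + √5) / 2 < ρ) : 1 < (ρ - 1) ^ 2 / ρ := by
  have h5 : √5 ^ 2 = 5 := Real.sq_sqrt (by norm_num)
  have h2 := Real.sqrt_nonneg 5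
  rw [one_lt_div (by linarith)]
  nlinarith

lemma two_lt_one_add : 2 < 1 + (1 + √5) / 2 := by
  have h5 : √5 ^ 2 = 5 := Real.sq_sqrt (by norm_num)
  nlinarith [Real.sqrt_nonneg 5]

end ReinforcedWalk

theorem corollary24
    {V : Type*} [Fintype V] [DecidableEq V] [MeasurableSpace V] [DiscreteMeasurableSpace V]
    (G : SimpleGraph V) [DecidableRel G.Adj] (hconn : G.Connected)
    (hedges : 2 ≤ G.edgeFinset.card)
    (ℓ₀ : Sym2 V → ℕ) (v₀ : V)
    (w : ℕ → ℝ) (hw : ∀ k, 0 < w k) (ρ : ℝ) (hρ : 1 < ρ)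
    {Ω : Type*} [MeasurableSpace Ω] (P : Measure Ω) [IsProbabilityMeasure P]
    (I : ℕ → Ω → V) (hI : ReinforcedWalk.IsERRW G w ℓ₀ v₀ P I) :
    ((∀ k : ℕ, 1 ≤ k → w k = (k : ℝ) ^ ρ) →
      (ρ ≤ 1 + (1 + √5) / 2 → ReinforcedWalk.expectedAttractionTime G ℓ₀ P I = ⊤) ∧
      (1 + (1 + √5) / 2 < ρ → ReinforcedWalk.expectedAttractionTime G ℓ₀ P I < ⊤)) ∧
    (∀ α : ℝ, 0 < α → (∀ k : ℕ, 2 ≤ k → w k = (k : ℝ) ^ ρ * Real.log k ^ α) →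
      (ρ < 1 + (1 + √5) / 2 ∨ (ρ = 1 + (1 + √5) / 2 ∧ α ≤ 1) →
        ReinforcedWalk.expectedAttractionTime G ℓ₀ P I = ⊤) ∧
      (1 + (1 + √5) / 2 < ρ ∨ (ρ = 1 + (1 + √5) / 2 ∧ 1 < α) →
        ReinforcedWalk.expectedAttractionTime G ℓ₀ P I < ⊤)) := by
  open ReinforcedWalk in
  have hv : ∃ y, G.Adj v₀ y := by
    obtain ⟨x, y, z, -, -, hyz⟩ := exists_adj_adj_ne hconn hedges
    have : Nontrivial V := ⟨y, z, hyz⟩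
    have := hconn.preconnected.degree_pos_of_nontrivial v₀
    rwa [SimpleGraph.degree_pos_iff_exists_adj] at this
  have infinite : ∀ α : ℝ, 0 ≤ α → (∀ k : ℕ, 2 ≤ k → w k = (k : ℝ) ^ ρ * Real.log k ^ α) →
      (ρ < 1 + (1 + √5) / 2 ∨ (ρ = 1 + (1 + √5) / 2 ∧ α ≤ 1)) →
      expectedAttractionTime G ℓ₀ P I = ⊤ := fun α hα hwk h =>
    hI.expectedAttractionTime_eq_top_of_regular hconn hedges hw hρ hα hwk
      (h.imp (sq_div_lt_one hρ) fun h => ⟨sq_div_eq_one h.1, h.2⟩)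
  have finite : ∀ α : ℝ, 0 ≤ α → (∀ k : ℕ, 2 ≤ k → w k = (k : ℝ) ^ ρ * Real.log k ^ α) →
      (1 + (1 + √5) / 2 < ρ ∨ (ρ = 1 + (1 + √5) / 2 ∧ 1 < α)) →
      expectedAttractionTime G ℓ₀ P I < ⊤ := fun α hα hwk h =>
    hI.expectedAttractionTime_lt_top_of_regular hv hw
      (by rcases h with h | h <;> linarith [two_lt_one_add]) hα hwk
      (h.imp one_lt_sq_div fun h => ⟨sq_div_eq_one h.1, h.2⟩)
  refine ⟨fun hwk => ?_, fun α hα hwk => ⟨infinite α hα.le hwk, finite α hα.le hwk⟩⟩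
  -- Pure powers are the case `α = 0`, which falls on the infinite side at the threshold.
  have hwk' : ∀ k : ℕ, 2 ≤ k → w k = (k : ℝ) ^ ρ * Real.log k ^ (0 : ℝ) := fun k hk => by
    rw [Real.rpow_zero, mul_one, hwk k (by omega)]
  refine ⟨fun h => infinite 0 le_rfl hwk' ?_, fun h => finite 0 le_rfl hwk' (Or.inl h)⟩
  exact h.lt_or_eq.imp_right fun h => ⟨h, zero_le_one⟩
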